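/- A one-counter automaton $(Q,\mathit{Act},\delta,\delta_0)$ consists of finite sets $Q$ of control states and $\mathit{Act}$ of actions and transition relations $\delta\subseteq Q\times\mathit{Act}\times\{-1,0,1\}\times Q$ and $\delta_0\subseteq Q\times\mathit{Act}\times\{0,1\}\times Q$. Its configurations (processes) are the pairs $pm$ with $p\in Q$, $m\in\mathbb N$, and $pm\xrightarrow{a}p'm'$ holds iff $(p,a,d,p')\in\delta$ and $m'=m+d\ge 0$ for some $d$, or $(p,a,d,p')\in\delta_0$, $m=0$ and $m'=d$ for some $d$. It is a one-counter net (OCN) if $\delta_0=\emptyset$. Let $\tau\in\mathit{Act}$ be a dedicated internal action, and let $\overset{\tau}{\Rightarrow}$ be $\xrightarrow{\tau}{}^{*}$ and $\overset{a}{\Rightarrow}$ be $\xrightarrow{\tau}{}^{*}\xrightarrow{a}\xrightarrow{\tau}{}^{*}$ for $a\ne\tau$. The set of strong traces of a process $\alpha$ is $T(\alpha)=\{w\in\mathit{Act}^*\mid\exists\beta:\ \alpha\xrightarrow{w}\beta\}$, and its set of weak traces is $T_\tau(\alpha)=\{w\in(\mathit{Act}\setminus\{\tau\})^*\mid\exists\beta:\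 \alpha\overset{w}{\Rightarrow}\beta\}$, where $\xrightarrow{w}$ and $\overset{w}{\Rightarrow}$ are the compositions of the corresponding steps along $w$. **Theorem** (Undecidability of trace inclusion and equivalence). Each of the following four problems is undecidable. Given an OCN with a dedicated action $\tau$ (presented as a finite list of transitions) and two of its processes $pm$ and $qn$, decide whether 1. $T(pm)\subseteq T(qn)$ (strong trace inclusion); 2. $T(pm)=T(qn)$ (strong trace equivalence); 3. $T_\tau(pm)\subseteq T_\tau(qn)$ (weak trace inclusion); 4. $T_\tau(pm)=T_\tau(qn)$ (weak trace equivalence). -/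

import Mathlib

/-! ### Labelled transition systems, strong and weak traces -/

/-- `LTSRun step s w t`: there is a path `s → ⋯ → t` labelled by the finite word `w`. -/
def LTSRun {V Act : Type*} (step : V → Act → V → Prop) : V → List Act → V → Prop
  | s, [], t => s = t
  | s, a :: w, t => ∃ u, step s a u ∧ LTSRun step u w t

/-- The set of (strong) traces of the state `s`. -/
def strongTraces {V Act : Type*} (step : V → Act → V → Prop) (s : V) : Set (List Act) :=
  {w | ∃ t, LTSRun step s w t}

/-- The weak step relation with respect to the internal action `τ`: a weak `τ`-step is a finite,
possibly empty, sequence of `τ`-steps; for `a ≠ τ`, a weak `a`-step is one `a`-step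
preceded and followed by finitely many `τ`-steps. -/
def weakStep {V Act : Type*} (τ : Act) (step : V → Act → V → Prop) (s : V) (a : Act) (t : V) :
    Prop :=
  (a = τ ∧ Relation.ReflTransGen (fun x y => step x τ y) s t) ∨
  (a ≠ τ ∧ ∃ u v, Relation.ReflTransGen (fun x y => step x τ y) s u ∧ step u a v ∧
    Relation.ReflTransGen (fun x y => step x τ y) v t)

/-- The set of weak traces of the state `s`: the words of observable actions (actions other
than `τ`) along which `s` can make a sequence of weak steps. -/
def weakTraces {V Act : Type*} (τ : Act) (step : V → Act → V → Prop) (s : V) :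
    Set (List Act) :=
  {w | τ ∉ w ∧ ∃ t, LTSRun (weakStep τ step) s w t}

/-! ### One-counter automata and nets -/

/-- A one-counter automaton with control states `Q` and actions `Act`. The type `SignType` is
`{-1, 0, 1}` and `Fin 2` is `{0, 1}`. -/
structure OneCounterAutomaton (Q Act : Type*) [Finite Q] [Finite Act] where
  /-- transitions available at every counter value (at which they do not make it negative) -/
  δ : Set (Q × Act × SignType × Q)
  /-- transitions available at counter value zero only -/
  δ₀ : Set (Q × Act × Fin 2 × Q)

namespace OneCounterAutomaton

variable {Q Act : Type*} [Finite Q] [Finite Act]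

/-- The transition relation on configurations `(p, m)`. In the first alternative the requirement
`m + d ≥ 0` is expressed by `m'` being a natural number. -/
def Step (A : OneCounterAutomaton Q Act) (c : Q × ℕ) (a : Act) (c' : Q × ℕ) : Prop :=
  (∃ d : SignType, (c.1, a, d, c'.1) ∈ A.δ ∧ (c'.2 : ℤ) = (c.2 : ℤ) + (d : ℤ)) ∨
  (∃ d : Fin 2, (c.1, a, d, c'.1) ∈ A.δ₀ ∧ c.2 = 0 ∧ c'.2 = (d : ℕ))

/-- A one-counter net is a one-counter automaton without zero tests. -/
def IsNet (A : OneCounterAutomaton Q Act) : Prop := A.δ₀ = ∅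

end OneCounterAutomaton

/-! ### Problem instances as finite data -/

/-- An instance of the trace problems: a one-counter net with control states
`0, …, numStates - 1`, actions `0, …, numActions - 1`, a dedicated internal action `τ` and a finite
list of transitions, together with two configurations `(p, m)` and `(q, n)` of the net. -/
structure OCNInstance where
  numStates : ℕ
  numActions : ℕ
  τ : ℕ
  transitions : List (ℕ × ℕ × SignType × ℕ)
  p : ℕ
  m : ℕ
  q : ℕ
  n : ℕ
  τ_lt : τ < numActions
  p_lt : p < numStates
  q_lt : q < numStates
  transitions_lt : ∀ t ∈ transitions, t.1 < numStates ∧ t.2.1 < numActions ∧ t.2.2.2 < numStates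

namespace OCNInstance

/-- The one-counter net of an instance. -/
def net (I : OCNInstance) : OneCounterAutomaton (Fin I.numStates) (Fin I.numActions) where
  δ := {t | ((t.1 : ℕ), (t.2.1 : ℕ), t.2.2.1, (t.2.2.2 : ℕ)) ∈ I.transitions}
  δ₀ := ∅

theorem net_isNet (I : OCNInstance) : I.net.IsNet := rfl

/-- The internal action of the net. -/
def tau (I : OCNInstance) : Fin I.numActions := ⟨I.τ, I.τ_lt⟩

/-- The first process of the instance, the configuration `pm`. -/
def left (I : OCNInstance) : Fin I.numStates × ℕ := (⟨I.p, I.p_lt⟩, I.m)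

/-- The second process of the instance, the configuration `qn`. -/
def right (I : OCNInstance) : Fin I.numStates × ℕ := (⟨I.q, I.q_lt⟩, I.n)

/-- Strong trace inclusion between the two processes of an instance. -/
def StrongTraceInclusion (I : OCNInstance) : Prop :=
  strongTraces I.net.Step I.left ⊆ strongTraces I.net.Step I.right

/-- Strong trace equivalence between the two processes of an instance. -/
def StrongTraceEquivalence (I : OCNInstance) : Prop :=
  strongTraces I.net.Step I.left = strongTraces I.net.Step I.right

/-- Weak trace inclusion between the two processes of an instance. -/
def WeakTraceInclusion (I : OCNInstance) : Prop :=
  weakTraces I.tau I.net.Step I.left ⊆ weakTraces I.tau I.net.Step I.right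

/-- Weak trace equivalence between the two processes of an instance. -/
def WeakTraceEquivalence (I : OCNInstance) : Prop :=
  weakTraces I.tau I.net.Step I.left = weakTraces I.tau I.net.Step I.right

end OCNInstance

/-! ### The standard effective encoding of instances, as tuples and lists of numbers -/

instance instPrimcodableSignType : Primcodable SignType :=
  Primcodable.ofEquiv (Fin 3) SignType.fin3Equiv.toEquiv

namespace OCNInstance

/-- The data of an instance, in the order
`((numStates, numActions, τ, transitions), (p, m), (q, n))`. -/
abbrev RawData : Type :=
  (ℕ × ℕ × ℕ × List (ℕ × ℕ × SignType × ℕ)) × (ℕ × ℕ) × (ℕ × ℕ)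

/-- All indices are within their ranges. -/
def WellFormed (c : RawData) : Prop :=
  (c.1.2.2.1 < c.1.2.1 ∧ c.2.1.1 < c.1.1 ∧ c.2.2.1 < c.1.1) ∧
  ∀ t ∈ c.1.2.2.2, t.1 < c.1.1 ∧ t.2.1 < c.1.2.1 ∧ t.2.2.2 < c.1.1

instance decidablePredWellFormed : DecidablePred WellFormed := fun c => by
  unfold WellFormed; infer_instance

theorem primrecPred_wellFormed : PrimrecPred WellFormed := by
  have h : PrimrecRel fun (t : ℕ × ℕ × SignType × ℕ) (c : RawData) =>
      t.1 < c.1.1 ∧ t.2.1 < c.1.2.1 ∧ t.2.2.2 < c.1.1 := by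
    have hS : Primrec fun x : (ℕ × ℕ × SignType × ℕ) × RawData => x.2.1.1 :=
      Primrec.fst.comp (Primrec.fst.comp Primrec.snd)
    have hA : Primrec fun x : (ℕ × ℕ × SignType × ℕ) × RawData => x.2.1.2.1 :=
      Primrec.fst.comp (Primrec.snd.comp (Primrec.fst.comp Primrec.snd))
    have hp : Primrec fun x : (ℕ × ℕ × SignType × ℕ) × RawData => x.1.1 :=
      Primrec.fst.comp Primrec.fst
    have ha : Primrec fun x : (ℕ × ℕ × SignType × ℕ) × RawData => x.1.2.1 :=
      Primrec.fst.comp (Primrec.snd.comp Primrec.fst)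
    have hq : Primrec fun x : (ℕ × ℕ × SignType × ℕ) × RawData => x.1.2.2.2 :=
      Primrec.snd.comp (Primrec.snd.comp (Primrec.snd.comp Primrec.fst))
    exact (Primrec.nat_lt.comp hp hS).and
      ((Primrec.nat_lt.comp ha hA).and (Primrec.nat_lt.comp hq hS))
  have hS : Primrec fun c : RawData => c.1.1 := Primrec.fst.comp Primrec.fst
  have hA : Primrec fun c : RawData => c.1.2.1 :=
    Primrec.fst.comp (Primrec.snd.comp Primrec.fst)
  have hτ : Primrec fun c : RawData => c.1.2.2.1 :=
    Primrec.fst.comp (Primrec.snd.comp (Primrec.snd.comp Primrec.fst))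
  have hL : Primrec fun c : RawData => c.1.2.2.2 :=
    Primrec.snd.comp (Primrec.snd.comp (Primrec.snd.comp Primrec.fst))
  have hp : Primrec fun c : RawData => c.2.1.1 :=
    Primrec.fst.comp (Primrec.fst.comp Primrec.snd)
  have hq : Primrec fun c : RawData => c.2.2.1 :=
    Primrec.fst.comp (Primrec.snd.comp Primrec.snd)
  exact ((Primrec.nat_lt.comp hτ hA).and
    ((Primrec.nat_lt.comp hp hS).and (Primrec.nat_lt.comp hq hS))).and
    (h.forall_mem_list.comp hL Primrec.id)

instance primcodableWellFormed : Primcodable {c : RawData // WellFormed c} :=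
  Primcodable.subtype primrecPred_wellFormed

/-- An instance is the same thing as well-formed data. -/
def equivRawData : OCNInstance ≃ {c : RawData // WellFormed c} where
  toFun I := ⟨((I.numStates, I.numActions, I.τ, I.transitions), (I.p, I.m), (I.q, I.n)),
    ⟨I.τ_lt, I.p_lt, I.q_lt⟩, I.transitions_lt⟩
  invFun c := ⟨c.1.1.1, c.1.1.2.1, c.1.1.2.2.1, c.1.1.2.2.2, c.1.2.1.1, c.1.2.1.2, c.1.2.2.1,
    c.1.2.2.2, c.2.1.1, c.2.1.2.1, c.2.1.2.2, c.2.2⟩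
  left_inv _ := rfl
  right_inv _ := rfl

instance primcodable : Primcodable OCNInstance :=
  Primcodable.ofEquiv _ equivRawData

end OCNInstance

/-! The halting problem reduces to non-inclusion of traces. A one-counter net cannot simulate
several registers, but a word of register operations can be checked for errors one register at a
time, and the right process may guess which register to check.

Fix a program `P` that, started with a code in register 0, can terminate exactly if the code halts
on input 0 (`CounterProg.exists_universal`). Complete words have the form `load^a`, operations,
`unload^b`, `halt`. The left process generates those whose operations follow the control flow of `P`
on input `n`, ignoring register contents; its counter only ensures `b ≤ a`. The right process
accepts every word without `halt`, and complete words with an error. With bound `K = a` it follows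
either `x r` or `K - x r`. A zero test of a positive register is refuted by one decrement of `x r`.
A decrement at zero or an increment at `K` pushes the followed value to `K + 1`, and a claimed
overflow is verified at the end by counting down against `unload^b halt`, which needs a value
greater than `b`.

If `P` cannot terminate, every complete left word has such an error (`exists_mem_traces_track`). If
it can, its execution with `a = b` large contains none, and no guess of the right process succeeds
(`notMem_traces_track`). Together these give `traces_left_subset_right_iff`. The left process also
has all initial moves of the right one, so inclusion and equivalence coincide; no transition is
labelled `τ`, so weak and strong traces coincide. -/

/-! ### Counter programs -/

/-- Elementary operations on registers indexed by `ℕ`. -/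
inductive CounterOp
  | nop
  | inc (r : ℕ)
  | dec (r : ℕ)
  | zero (r : ℕ)
  deriving Encodable

namespace CounterOp

/-- The effect of an operation on a store. Decrements need a positive register and zero tests a
vanishing one. -/
def Step (x : ℕ → ℕ) : CounterOp → (ℕ → ℕ) → Prop
  | nop, y => y = x
  | inc r, y => y = Function.update x r (x r + 1)
  | dec r, y => x r ≠ 0 ∧ y = Function.update x r (x r - 1)
  | zero r, y => x r = 0 ∧ y = x

/-- All registers of the operation are smaller than `k`. -/
def Below (k : ℕ) : CounterOp → Prop
  | nop => True
  | inc r => r < k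
  | dec r => r < k
  | zero r => r < k

end CounterOp

/-- Programs: regular expressions over the elementary operations. -/
inductive CounterProg
  | op (o : CounterOp)
  | seq (P Q : CounterProg)
  | star (P : CounterProg)
  deriving Encodable

namespace CounterProg

open Function

/-- The input-output relation of a program. -/
def Rel : CounterProg → (ℕ → ℕ) → (ℕ → ℕ) → Prop
  | op o => fun x y => CounterOp.Step x o y
  | seq P Q => fun x y => ∃ z, Rel P x z ∧ Rel Q z y
  | star P => Relation.ReflTransGen (Rel P)

/-- Started in `x`, the program can terminate in `y` and in no other store. -/
def Computes (P : CounterProg) (x y : ℕ → ℕ) : Prop := ∀ z, Rel P x z ↔ z = y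

/-! ### Determinate programs and loops -/

theorem Computes.seq {P Q : CounterProg} {x y z : ℕ → ℕ} (hP : P.Computes x y)
    (hQ : Q.Computes y z) : (P.seq Q).Computes x z := by
  intro w
  constructor
  · rintro ⟨u, hu, hw⟩
    rw [(hP u).1 hu] at hw
    exact (hQ w).1 hw
  · rintro rfl
    exact ⟨y, (hP y).2 rfl, (hQ _).2 rfl⟩

theorem Computes.of_eq {P : CounterProg} {x y z : ℕ → ℕ} (h : z = y) (hP : P.Computes x y) :
    P.Computes x z := h ▸ hP

theorem computes_nop (x : ℕ → ℕ) : (op .nop).Computes x x := fun _ => Iff.rfl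

theorem computes_inc (x : ℕ → ℕ) (r : ℕ) :
    (op (.inc r)).Computes x (update x r (x r + 1)) := fun _ => Iff.rfl

/-- Repeat `P` as long as register `r`, which is decremented before each execution, is positive. -/
def loop (r : ℕ) (P : CounterProg) : CounterProg :=
  ((op (.dec r)).seq P).star.seq (op (.zero r))

theorem loop_computes_of_eq_zero {r : ℕ} (P : CounterProg) {x : ℕ → ℕ} (h : x r = 0) :
    (loop r P).Computes x x := by
  intro z
  constructor
  · rintro ⟨y, hy, hz⟩
    rcases Relation.ReflTransGen.cases_head hy with rfl | ⟨u, ⟨v, hv, -⟩, -⟩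
    · exact hz.2
    · exact absurd h hv.1
  · rintro rfl
    exact ⟨z, .refl, h, rfl⟩

/-- The star may nondeterministically stop at any round, but stopping early fails the closing zero
test and continuing too long fails the decrement. So the loop has exactly one successful execution.
-/
theorem loop_computes_of_ne_zero {r : ℕ} {P : CounterProg} {x y z : ℕ → ℕ} (h : x r ≠ 0)
    (hP : P.Computes (update x r (x r - 1)) y) (hy : (loop r P).Computes y z) :
    (loop r P).Computes x z := by
  intro w
  constructor
  · rintro ⟨t, ht, hw⟩
    rcases Relation.ReflTransGen.cases_head ht with rfl | ⟨u, ⟨v, hv, hu⟩, hut⟩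
    · exact absurd hw.1 h
    · rw [hv.2] at hu
      rw [(hP u).1 hu] at hut
      exact (hy w).1 ⟨t, hut, hw⟩
  · rintro rfl
    obtain ⟨t, ht, hw⟩ := (hy w).2 rfl
    exact ⟨t, .head ⟨_, ⟨h, rfl⟩, (hP y).2 rfl⟩ ht, hw⟩

/-- Set register `r` to zero. -/
def clear (r : ℕ) : CounterProg := loop r (op .nop)

theorem clear_computes (r : ℕ) (x : ℕ → ℕ) : (clear r).Computes x (update x r 0) := by
  generalize hm : x r = m
  induction m generalizing x with
  | zero =>
    have : update x r 0 = x := by rw [← hm, update_eq_self]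
    rw [this]
    exact loop_computes_of_eq_zero _ hm
  | succ m ih =>
    refine loop_computes_of_ne_zero (by omega) (computes_nop _) ?_
    exact .of_eq (by simp) (ih (update x r (x r - 1)) (by simp [hm]))

/-- Add register `r` to register `s` and set `r` to zero. -/
def move (r s : ℕ) : CounterProg := loop r (op (.inc s))

theorem move_computes {r s : ℕ} (h : r ≠ s) (x : ℕ → ℕ) :
    (move r s).Computes x (update (update x r 0) s (x s + x r)) := by
  generalize hm : x r = m
  induction m generalizing x with
  | zero =>
    have : update (update x r 0) s (x s + 0) = x := by
      rw [← hm, update_eq_self]; simp [hm]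
    rw [this]
    exact loop_computes_of_eq_zero _ hm
  | succ m ih =>
    refine loop_computes_of_ne_zero (by omega) (computes_inc _ s) ?_
    refine .of_eq ?_ (ih _ ?_)
    · funext i
      simp only [update_apply]
      split_ifs <;> omega
    · simp [update_apply, h, hm]

/-- Add register `r` to the registers `s` and `t` and set `r` to zero. -/
def moveBoth (r s t : ℕ) : CounterProg := loop r ((op (.inc s)).seq (op (.inc t)))

theorem moveBoth_computes {r s t : ℕ} (hs : r ≠ s) (ht : r ≠ t) (hst : s ≠ t) (x : ℕ → ℕ) :
    (moveBoth r s t).Computes x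
      (update (update (update x r 0) s (x s + x r)) t (x t + x r)) := by
  generalize hm : x r = m
  induction m generalizing x with
  | zero =>
    have : update (update (update x r 0) s (x s + 0)) t (x t + 0) = x := by
      rw [← hm, update_eq_self]; simp [hm]
    rw [this]
    exact loop_computes_of_eq_zero _ hm
  | succ m ih =>
    refine loop_computes_of_ne_zero (by omega) ((computes_inc _ s).seq (computes_inc _ t)) ?_
    refine .of_eq ?_ (ih _ ?_)
    · funext i
      simp only [update_apply]
      split_ifs <;> omega
    · simp [update_apply, hs, ht, hm]

/-- Add register `r` to register `s`, using the register `t` as scratch space. -/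
def copy (r s t : ℕ) : CounterProg := (moveBoth r s t).seq (move t r)

theorem copy_computes {r s t : ℕ} (hs : r ≠ s) (ht : r ≠ t) (hst : s ≠ t) {x : ℕ → ℕ}
    (hx : x t = 0) : (copy r s t).Computes x (update x s (x s + x r)) := by
  refine .of_eq ?_ ((moveBoth_computes hs ht hst x).seq (move_computes ht.symm _))
  funext i
  simp only [update_apply]
  split_ifs <;> first | omega | simp_all

/-- `f` is computable by programs that leave the inputs unchanged, add the output to the first
scratch register, and reset all other scratch registers to zero. -/
def Realizable {n : ℕ} (f : List.Vector ℕ n → ℕ) : Prop :=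
  ∀ (ins : List.Vector ℕ n) (b : ℕ), (∀ i, ins.get i < b) → ∃ P : CounterProg,
    ∀ x : ℕ → ℕ, (∀ i, b ≤ i → x i = 0) → P.Computes x (update x b (f (ins.map x)))

/-! ### Compiling primitive recursive functions -/

theorem realizable_zero : Realizable fun _ : List.Vector ℕ 0 => 0 := by
  intro ins b _
  refine ⟨op .nop, fun x hx => ?_⟩
  have : update x b 0 = x := by rw [← hx b le_rfl, update_eq_self]
  rw [this]
  exact computes_nop x

theorem realizable_get {n : ℕ} (i : Fin n) : Realizable fun v : List.Vector ℕ n => v.get i := by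
  intro ins b hb
  refine ⟨copy (ins.get i) b (b + 1), fun x hx => ?_⟩
  have h := hb i
  simpa [hx b le_rfl] using
    copy_computes (by omega) (by omega) (by omega) (hx (b + 1) (by omega)) (r := ins.get i)
      (s := b) (t := b + 1)

theorem realizable_succ : Realizable fun v : List.Vector ℕ 1 => v.head.succ := by
  intro ins b hb
  obtain ⟨P, hP⟩ := realizable_get (0 : Fin 1) ins b hb
  refine ⟨P.seq (op (.inc b)), fun x hx => ?_⟩
  simpa using (hP x hx).seq (computes_inc _ b)

/-- Clear the registers `b, …, b + m - 1`. -/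
def clearRange (b : ℕ) : ℕ → CounterProg
  | 0 => op .nop
  | m + 1 => (clearRange b m).seq (clear (b + m))

theorem clearRange_computes (b m : ℕ) (x : ℕ → ℕ) :
    (clearRange b m).Computes x fun i => if b ≤ i ∧ i < b + m then 0 else x i := by
  induction m with
  | zero =>
    refine .of_eq ?_ (computes_nop x)
    funext i
    rw [if_neg (by omega)]
  | succ m ih =>
    refine .of_eq ?_ (ih.seq (clear_computes (b + m) _))
    funext i
    simp only [update_apply]
    split_ifs <;> omega

/-- Intermediate form of composition: the inner values are stored side by side from `b` on, and
induction on `l` adds one at a time. -/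
theorem exists_computes_family {m n : ℕ} {g : Fin n → List.Vector ℕ m → ℕ}
    (hg : ∀ i, Realizable (g i)) (ins : List.Vector ℕ m) (b : ℕ) (hb : ∀ i, ins.get i < b)
    (l : ℕ) (hl : l ≤ n) :
    ∃ P : CounterProg, ∀ x : ℕ → ℕ, (∀ i, b ≤ i → x i = 0) → P.Computes x fun i =>
      if h : b ≤ i ∧ i < b + l then g ⟨i - b, by omega⟩ (ins.map x) else x i := by
  induction l with
  | zero =>
    refine ⟨op .nop, fun x _ => ?_⟩
    refine .of_eq ?_ (computes_nop x)
    funext i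
    rw [dif_neg (by omega)]
  | succ l ih =>
    obtain ⟨P, hP⟩ := ih (by omega)
    -- Moving the scratch base to `b + l` protects the values already stored.
    obtain ⟨Q, hQ⟩ := hg ⟨l, by omega⟩ ins (b + l) fun i => (hb i).trans_le (by omega)
    refine ⟨P.seq Q, fun x hx => ?_⟩
    refine .of_eq ?_ ((hP x hx).seq (hQ _ ?_))
    · have hins : (ins.map fun i => if h : b ≤ i ∧ i < b + l then
          g ⟨i - b, by omega⟩ (ins.map x) else x i) = ins.map x := by
        ext j
        have := hb j
        simp only [List.Vector.get_map]
        rw [dif_neg (by omega)]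
      rw [hins]
      funext i
      simp only [update_apply]
      by_cases hi : i = b + l
      · subst hi
        simp
      · rw [if_neg hi]
        by_cases h : b ≤ i ∧ i < b + l
        · rw [dif_pos h, dif_pos (by omega)]
        · rw [dif_neg h, dif_neg (by omega)]
    · intro i hi
      rw [dif_neg (by omega)]
      exact hx i (by omega)

theorem Realizable.comp {m n : ℕ} {f : List.Vector ℕ n → ℕ} (g : Fin n → List.Vector ℕ m → ℕ)
    (hf : Realizable f) (hg : ∀ i, Realizable (g i)) :
    Realizable fun v => f (List.Vector.ofFn fun i => g i v) := by
  intro ins b hb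
  obtain ⟨P, hP⟩ := exists_computes_family hg ins b hb n le_rfl
  -- The result goes to `b + n + 1` rather than `b + n`: for `n = 0` the latter would be `b` itself,
  -- and the final `move` needs distinct registers.
  obtain ⟨Q, hQ⟩ := hf (List.Vector.ofFn fun i : Fin n => b + i) (b + n + 1) fun i => by
    rw [List.Vector.get_ofFn]; omega
  refine ⟨((P.seq Q).seq (clearRange b n)).seq (move (b + n + 1) b), fun x hx => ?_⟩
  refine .of_eq ?_ ((((hP x hx).seq (hQ _ ?_)).seq (clearRange_computes b n _)).seq
    (move_computes (by omega) _))
  · set v := List.Vector.ofFn fun i => g i (ins.map x) with hv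
    have : ((List.Vector.ofFn fun i : Fin n => b + (i : ℕ)).map fun i =>
        if h : b ≤ i ∧ i < b + n then g ⟨i - b, by omega⟩ (ins.map x) else x i) = v := by
      ext j
      simp [hv]
    rw [this]
    have h0 := hx (b + n + 1) (by omega)
    funext i
    simp only [update_apply]
    split_ifs <;> first | omega | rfl | simp_all
  · intro i hi
    rw [dif_neg (by omega)]
    exact hx i (by omega)

/-- Register `b` holds the current value, `b + 1` the round number, `b + 2` the number of rounds
left, and `b + 3` receives the next value. The recursion argument is copied to `b + 2` because the
loop destroys its counter while inputs must survive. -/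
theorem Realizable.prec {n : ℕ} {f : List.Vector ℕ n → ℕ} {g : List.Vector ℕ (n + 2) → ℕ}
    (hf : Realizable f) (hg : Realizable g) :
    Realizable fun v : List.Vector ℕ (n + 1) =>
      v.head.rec (f v.tail) fun y IH => g (y ::ᵥ IH ::ᵥ v.tail) := by
  intro ins b hb
  have hhead : ins.head < b := by simpa using hb 0
  have htail : ∀ i, ins.tail.get i < b := fun i => by simpa using hb i.succ
  obtain ⟨P, hP⟩ := hf ins.tail b htail
  obtain ⟨Q, hQ⟩ := hg ((b + 1) ::ᵥ b ::ᵥ ins.tail) (b + 3) fun i => by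
    refine Fin.cases ?_ (fun i => Fin.cases ?_ (fun i => ?_) i) i
    · simp
    · exact Nat.lt_add_of_pos_right (by omega)
    · simpa using (htail i).trans (by omega)
  let body := ((Q.seq (clear b)).seq (move (b + 3) b)).seq (op (.inc (b + 1)))
  refine ⟨((P.seq (copy ins.head (b + 2) (b + 3))).seq (loop (b + 2) body)).seq (clear (b + 1)),
    fun x hx => ?_⟩
  set v := ins.tail.map x with hv
  let F : ℕ → ℕ := fun m => m.rec (f v) fun y IH => g (y ::ᵥ IH ::ᵥ v)
  -- the store after `y` rounds with `m` rounds left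
  let X : ℕ → ℕ → ℕ → ℕ := fun y m =>
    update (update (update x b (F y)) (b + 1) y) (b + 2) m
  have hX : ∀ y m i, i < b → X y m i = x i := fun y m i hi => by
    simp only [X, update_apply]
    rw [if_neg (by omega), if_neg (by omega), if_neg (by omega)]
  have hX' : ∀ y m i, b + 3 ≤ i → X y m i = 0 := fun y m i hi => by
    simp only [X, update_apply]
    rw [if_neg (by omega), if_neg (by omega), if_neg (by omega)]
    exact hx i (by omega)
  have hb0 : ∀ y m, X y m b = F y := fun y m => by simp [X]
  have hb1 : ∀ y m, X y m (b + 1) = y := fun y m => by simp [X]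
  have hb2 : ∀ y m, X y m (b + 2) = m := fun y m => by simp [X]
  have hbody : ∀ y m, body.Computes (X y m) (X (y + 1) m) := by
    intro y m
    refine .of_eq ?_ ((((hQ (X y m) (hX' y m)).seq (clear_computes b _)).seq
      (move_computes (by omega) _)).seq (computes_inc _ (b + 1)))
    have hins : ((b + 1) ::ᵥ b ::ᵥ ins.tail).map (X y m) = y ::ᵥ F y ::ᵥ v := by
      rw [List.Vector.map_cons, List.Vector.map_cons, hb0, hb1]
      congr 2
      ext j
      simp only [hv, List.Vector.get_map]
      exact hX _ _ _ (htail j)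
    rw [hins]
    have hF : g (y ::ᵥ F y ::ᵥ v) = F (y + 1) := rfl
    rw [hF]
    have h3 := hX' y m (b + 3) le_rfl
    funext i
    simp only [X, update_apply]
    split_ifs <;> first | omega | rfl | simp_all
  have hloop : ∀ m y, (loop (b + 2) body).Computes (X y m) (X (y + m) 0) := by
    intro m
    induction m with
    | zero => exact fun y => loop_computes_of_eq_zero _ (hb2 y 0)
    | succ m ih =>
      intro y
      refine loop_computes_of_ne_zero (by simp [hb2]) (y := X (y + 1) m) ?_ ?_
      · have : update (X y (m + 1)) (b + 2) (X y (m + 1) (b + 2) - 1) = X y m := by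
          rw [hb2]
          simp [X]
        rw [this]
        exact hbody y m
      · convert ih (y + 1) using 2
        omega
  have hstart : (P.seq (copy ins.head (b + 2) (b + 3))).Computes x (X 0 (x ins.head)) := by
    refine .of_eq ?_ ((hP x hx).seq (copy_computes (r := ins.head)
      (s := b + 2) (t := b + 3) (by omega)
      (by omega) (by omega) ?_))
    · have h1 := hx (b + 1) (by omega)
      have h2 := hx (b + 2) (by omega)
      funext i
      simp only [X, update_apply]
      split_ifs <;> first | omega | rfl | simp_all
    · simp [hx]
  refine .of_eq ?_ ((hstart.seq (hloop _ 0)).seq (clear_computes (b + 1) _))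
  have h1 := hx (b + 1) (by omega)
  have h2 := hx (b + 2) (by omega)
  beta_reduce
  have hF : (Nat.rec (f (ins.map x).tail) (fun y IH => g (y ::ᵥ IH ::ᵥ (ins.map x).tail))
      (ins.map x).head : ℕ) = F (0 + x ins.head) := by
    simp only [List.Vector.head_map, List.Vector.tail_map, zero_add, F, hv]
  rw [hF]
  funext i
  simp only [X, update_apply]
  split_ifs <;> first | omega | rfl | simp_all

theorem realizable_of_primrec {n : ℕ} {f : List.Vector ℕ n → ℕ} (hf : Nat.Primrec' f) :
    Realizable f := by
  induction hf with
  | zero => exact realizable_zero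
  | succ => exact realizable_succ
  | get i => exact realizable_get i
  | comp g _ _ hf hg => exact hf.comp g hg
  | prec _ _ hf hg => exact hf.prec hg

/-- Every projection of a primitive recursive relation is the domain of a program. -/
theorem exists_rel_iff {G : List.Vector ℕ 2 → ℕ} (hG : Nat.Primrec' G) :
    ∃ P : CounterProg, ∀ n : ℕ,
      (∃ y, P.Rel (update (fun _ => 0) 0 n) y) ↔ ∃ k, G (k ::ᵥ n ::ᵥ .nil) = 0 := by
  obtain ⟨P, hP⟩ := realizable_of_primrec hG (1 ::ᵥ 0 ::ᵥ .nil) 2 fun i => by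
    refine Fin.cases ?_ (fun i => ?_) i
    · simp
    · have : (1 ::ᵥ 0 ::ᵥ .nil : List.Vector ℕ 2).get i.succ = 0 := by
        rw [List.Vector.get_cons_succ, Subsingleton.elim i 0, List.Vector.get_zero,
          List.Vector.head_cons]
      omega
  -- The star guesses the witness `k` in register 1; the value of `G` arrives in register 2, and the
  -- zero test lets only correct guesses terminate.
  refine ⟨(op (.inc 1)).star.seq (P.seq (op (.zero 2))), fun n => ?_⟩
  let X : ℕ → ℕ → ℕ := fun k => update (update (fun _ => 0) 0 n) 1 k
  have hguess : ∀ z, (op (.inc 1)).star.Rel (update (fun _ => 0) 0 n) z ↔ ∃ k, z = X k := by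
    intro z
    constructor
    · intro h
      induction h with
      | refl => exact ⟨0, by funext i; simp only [X, update_apply]; split_ifs <;> simp_all⟩
      | tail _ hs ih =>
        obtain ⟨k, rfl⟩ := ih
        exact ⟨k + 1, by rw [hs]; simp [X]⟩
    · rintro ⟨k, rfl⟩
      induction k with
      | zero =>
        have : X 0 = update (fun _ => 0) 0 n := by
          funext i; simp only [X, update_apply]; split_ifs <;> simp_all
        rw [this]
        exact .refl
      | succ k ih => exact .tail ih (by simp [Rel, CounterOp.Step, X])
  have hX : ∀ k, ((1 ::ᵥ 0 ::ᵥ .nil : List.Vector ℕ 2).map (X k)) = k ::ᵥ n ::ᵥ .nil := by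
    intro k
    simp [X]
  have hP' : ∀ k, P.Computes (X k) (update (X k) 2 (G (k ::ᵥ n ::ᵥ .nil))) := by
    intro k
    have := hP (X k) fun i hi => by
      simp only [X, update_apply]
      rw [if_neg (by omega), if_neg (by omega)]
    rwa [hX] at this
  constructor
  · rintro ⟨y, z, hz, u, hu, hy⟩
    obtain ⟨k, rfl⟩ := (hguess z).1 hz
    rw [(hP' k u).1 hu] at hy
    exact ⟨k, by simpa using hy.1⟩
  · rintro ⟨k, hk⟩
    exact ⟨_, X k, (hguess _).2 ⟨k, rfl⟩, _, (hP' k _).2 rfl, by simpa using hk, rfl⟩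

end CounterProg

/-! ### The automaton of a counter program -/

theorem LTSRun.append {V Act : Type*} {step : V → Act → V → Prop} {s t u : V} {v w : List Act}
    (h₁ : LTSRun step s v t) (h₂ : LTSRun step t w u) : LTSRun step s (v ++ w) u := by
  induction v generalizing s with
  | nil => obtain rfl : s = t := h₁; exact h₂
  | cons a v ih => obtain ⟨x, hx, h⟩ := h₁; exact ⟨x, hx, ih h⟩

namespace CounterProg

open Function

/-- One step of the automaton whose states are the lists of programs still to be executed. -/
inductive Edge : List CounterProg → CounterOp → List CounterProg → Prop
  | op (o : CounterOp) (k : List CounterProg) : Edge (op o :: k) o k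
  | seq (P Q : CounterProg) (k : List CounterProg) : Edge (P.seq Q :: k) .nop (P :: Q :: k)
  | star_exit (P : CounterProg) (k : List CounterProg) : Edge (P.star :: k) .nop k
  | star_enter (P : CounterProg) (k : List CounterProg) :
      Edge (P.star :: k) .nop (P :: P.star :: k)

/-- The input-output relation of a list of programs. -/
def StackRel : List CounterProg → (ℕ → ℕ) → (ℕ → ℕ) → Prop
  | [], x, y => x = y
  | P :: k, x, y => ∃ z, P.Rel x z ∧ StackRel k z y

/-! ### Executions as runs of a finite automaton -/

theorem exists_run_of_rel (P : CounterProg) : ∀ (k : List CounterProg) (x y : ℕ → ℕ),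
    P.Rel x y → ∃ w, LTSRun Edge (P :: k) w k ∧ LTSRun CounterOp.Step x w y := by
  induction P with
  | op o => exact fun k x y h => ⟨[o], ⟨k, .op o k, rfl⟩, y, h, rfl⟩
  | seq P Q ihP ihQ =>
    rintro k x y ⟨z, hP, hQ⟩
    obtain ⟨v, hv, hv'⟩ := ihP (Q :: k) x z hP
    obtain ⟨w, hw, hw'⟩ := ihQ k z y hQ
    exact ⟨.nop :: (v ++ w), ⟨_, .seq P Q k, hv.append hw⟩, x, rfl, hv'.append hw'⟩
  | star P ih =>
    intro k x y h
    induction h using Relation.ReflTransGen.head_induction_on with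
    | refl => exact ⟨[.nop], ⟨k, .star_exit P k, rfl⟩, y, rfl, rfl⟩
    | @head x z hP _ ihs =>
      obtain ⟨v, hv, hv'⟩ := ih (P.star :: k) x z hP
      obtain ⟨w, hw, hw'⟩ := ihs
      exact ⟨.nop :: (v ++ w), ⟨_, .star_enter P k, hv.append hw⟩, x, rfl, hv'.append hw'⟩

/-- Backward preservation: an edge unfolds the first program of the list, so a relation that holds
after the step holds before it. -/
theorem StackRel.of_edge {k k' : List CounterProg} {o : CounterOp} {x x' y : ℕ → ℕ}
    (he : Edge k o k') (hx : CounterOp.Step x o x') (h : StackRel k' x' y) : StackRel k x y := by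
  cases he with
  | op o k => exact ⟨x', hx, h⟩
  | seq P Q k =>
    obtain rfl : x' = x := hx
    obtain ⟨z, hP, t, hQ, hk⟩ := h
    exact ⟨t, ⟨z, hP, hQ⟩, hk⟩
  | star_exit P k =>
    obtain rfl : x' = x := hx
    exact ⟨x', .refl, h⟩
  | star_enter P k =>
    obtain rfl : x' = x := hx
    obtain ⟨z, hP, t, hs, hk⟩ := h
    exact ⟨t, .head hP hs, hk⟩

theorem stackRel_of_run {k : List CounterProg} {w : List CounterOp} {x y : ℕ → ℕ}
    (hk : LTSRun Edge k w []) (hx : LTSRun CounterOp.Step x w y) : StackRel k x y := by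
  induction w generalizing k x with
  | nil => obtain rfl : k = [] := hk; exact hx
  | cons o w ih =>
    obtain ⟨k', he, hk⟩ := hk
    obtain ⟨x', hs, hx⟩ := hx
    exact .of_edge he hs (ih hk hx)

theorem rel_iff_exists_run (P : CounterProg) (x y : ℕ → ℕ) :
    P.Rel x y ↔ ∃ w, LTSRun Edge [P] w [] ∧ LTSRun CounterOp.Step x w y := by
  refine ⟨exists_run_of_rel P [] x y, ?_⟩
  rintro ⟨w, hw, hx⟩
  obtain ⟨z, hP, rfl⟩ := stackRel_of_run hw hx
  exact hP

/-- The states of the automaton met in an execution of `P` that is to be followed by `k`. -/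
def stackSet : CounterProg → List CounterProg → Set (List CounterProg)
  | op o, k => {op o :: k}
  | seq P Q, k => {P.seq Q :: k} ∪ (stackSet P (Q :: k) ∪ stackSet Q k)
  | star P, k => {P.star :: k} ∪ stackSet P (P.star :: k)

theorem finite_stackSet (P : CounterProg) (k : List CounterProg) : (stackSet P k).Finite := by
  induction P generalizing k with
  | op o => exact Set.finite_singleton _
  | seq P Q ihP ihQ => exact (Set.finite_singleton _).union ((ihP _).union (ihQ _))
  | star P ih => exact (Set.finite_singleton _).union (ih _)

theorem cons_mem_stackSet (P : CounterProg) (k : List CounterProg) : P :: k ∈ stackSet P k := by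
  cases P <;> simp [stackSet]

/-- The states reachable from `P :: k` close up because the body of a star runs with the star itself
as continuation, so leaving the body returns to a state already listed. This makes the control
finite. -/
theorem mem_stackSet_of_edge (P : CounterProg) (k : List CounterProg) {s t : List CounterProg}
    {o : CounterOp} (hs : s ∈ stackSet P k) (h : Edge s o t) : t ∈ stackSet P k ∨ t = k := by
  induction P generalizing k with
  | op o' =>
    obtain rfl : s = _ := hs
    cases h
    exact .inr rfl
  | seq P Q ihP ihQ =>
    rcases hs with hs | hs | hs
    · obtain rfl : s = _ := hs
      cases h
      exact .inl (.inr (.inl (cons_mem_stackSet _ _)))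
    · rcases ihP _ hs with h | rfl
      · exact .inl (.inr (.inl h))
      · exact .inl (.inr (.inr (cons_mem_stackSet _ _)))
    · rcases ihQ _ hs with h | rfl
      · exact .inl (.inr (.inr h))
      · exact .inr rfl
  | star P ih =>
    rcases hs with hs | hs
    · obtain rfl : s = _ := hs
      cases h
      · exact .inr rfl
      · exact .inl (.inr (cons_mem_stackSet _ _))
    · rcases ih _ hs with h | rfl
      · exact .inl (.inr h)
      · exact .inl (.inl rfl)

/-- The edges of the automaton of `P`. -/
def edges (P : CounterProg) : Set (List CounterProg × CounterOp × List CounterProg) :=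
  {t | t.1 ∈ stackSet P [] ∧ Edge t.1 t.2.1 t.2.2}

theorem finite_edges (P : CounterProg) : P.edges.Finite := by
  refine ((finite_stackSet P []).biUnion (t := fun s => {t | t.1 = s ∧ Edge s t.2.1 t.2.2})
    fun s _ => ?_).subset fun t ht => Set.mem_biUnion ht.1 ⟨rfl, ht.2⟩
  rcases s with _ | ⟨o | ⟨P, Q⟩ | P, k⟩
  · refine Set.finite_empty.subset ?_
    rintro ⟨s, o, t⟩ ⟨-, h⟩
    cases h
  · refine (Set.finite_singleton (op o :: k, o, k)).subset ?_
    rintro ⟨s, o', t⟩ ⟨rfl, h⟩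
    change Edge _ o' t at h
    cases h
    rfl
  · refine (Set.finite_singleton (P.seq Q :: k, CounterOp.nop, P :: Q :: k)).subset ?_
    rintro ⟨s, o', t⟩ ⟨rfl, h⟩
    change Edge _ o' t at h
    cases h
    rfl
  · refine (Set.toFinite {(P.star :: k, CounterOp.nop, k),
      (P.star :: k, CounterOp.nop, P :: P.star :: k)}).subset ?_
    rintro ⟨s, o, t⟩ ⟨rfl, h⟩
    change Edge _ o t at h
    cases h
    · exact .inl rfl
    · exact .inr rfl

theorem run_edges_iff (P : CounterProg) (w : List CounterOp) :
    LTSRun (fun s o t => (s, o, t) ∈ P.edges) [P] w [] ↔ LTSRun Edge [P] w [] := by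
  have h : ∀ s, s ∈ stackSet P [] ∨ s = [] →
      (LTSRun (fun s o t => (s, o, t) ∈ P.edges) s w [] ↔ LTSRun Edge s w []) := by
    induction w with
    | nil => exact fun s _ => Iff.rfl
    | cons o w ih =>
      intro s hs
      constructor
      · rintro ⟨t, ht, hw⟩
        exact ⟨t, ht.2, (ih t (mem_stackSet_of_edge P [] ht.1 ht.2)).1 hw⟩
      · rintro ⟨t, ht, hw⟩
        rcases hs with hs | rfl
        · exact ⟨t, ⟨hs, ht⟩, (ih t (mem_stackSet_of_edge P [] hs ht)).2 hw⟩
        · cases ht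
  exact h _ (.inl (cons_mem_stackSet P []))

/-- All operations of the program use registers below a common bound. -/
theorem exists_below (P : CounterProg) : ∃ k, 0 < k ∧ ∀ t ∈ P.edges, t.2.1.Below k := by
  have hmono : ∀ (o : CounterOp) {k l : ℕ}, k ≤ l → o.Below k → o.Below l := by
    intro o k l h ho
    cases o <;> simp only [CounterOp.Below] at * <;> omega
  have hex : ∀ o : CounterOp, ∃ k, o.Below k := by
    rintro (_ | r | r | r)
    · exact ⟨0, trivial⟩
    all_goals exact ⟨r + 1, Nat.lt_succ_self r⟩
  choose g hg using hex
  obtain ⟨B, hB⟩ := (P.finite_edges.image fun t => g t.2.1).bddAbove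
  exact ⟨B + 1, by omega, fun t ht => hmono _
    ((hB (Set.mem_image_of_mem (fun t => g t.2.1) ht)).trans (Nat.le_succ B)) (hg _)⟩

theorem run_replicate_inc (n : ℕ) (x y : ℕ → ℕ) (u : List CounterOp) :
    LTSRun CounterOp.Step x (List.replicate n (.inc 0) ++ u) y ↔
      LTSRun CounterOp.Step (update x 0 (x 0 + n)) u y := by
  induction n generalizing x with
  | zero => simp
  | succ n ih =>
    constructor
    · rintro ⟨z, rfl, h⟩
      have := (ih _).1 h
      simpa [Nat.add_assoc, Nat.add_comm 1] using this
    · intro h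
      refine ⟨_, rfl, (ih _).2 ?_⟩
      simpa [Nat.add_assoc, Nat.add_comm 1] using h

end CounterProg

/-! ### The one-counter net of a counter program -/

theorem cons_mem_strongTraces {V Act : Type*} {step : V → Act → V → Prop} {s : V} {a : Act}
    {w : List Act} :
    a :: w ∈ strongTraces step s ↔ ∃ t, step s a t ∧ w ∈ strongTraces step t := by
  constructor
  · rintro ⟨u, t, ht, hu⟩
    exact ⟨t, ht, u, hu⟩
  · rintro ⟨t, ht, u, hu⟩
    exact ⟨u, t, ht, hu⟩

theorem nil_mem_strongTraces {V Act : Type*} {step : V → Act → V → Prop} {s : V} :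
    [] ∈ strongTraces step s := ⟨s, rfl⟩

/-- The configuration steps of a one-counter net given by its transition relation. -/
def NetStep {S A : Type*} (T : S → A → SignType → S → Prop) (c : S × ℕ) (a : A) (c' : S × ℕ) :
    Prop :=
  ∃ d, T c.1 a d c'.1 ∧ (c'.2 : ℤ) = (c.2 : ℤ) + (d : ℤ)

namespace ProgramNet

/-- Actions of the net. -/
inductive Letter
  | tau
  | load
  | op (o : CounterOp)
  | unload
  | halt
  deriving Encodable

/-- The actions that occur in transitions, for operations on the registers below `k`. -/
def Letter.Used (k : ℕ) : Letter → Prop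
  | tau => False
  | load => True
  | op o => o.Below k
  | unload => True
  | halt => True

/-- Control states of the net: `load`, `chain`, `ctl`, `unload` and `done` generate executions of
a program with a common bound on its registers, the others detect errors in them. -/
inductive State
  | start (left : Bool)
  | load
  | chain (j : ℕ)
  | ctl (q : List CounterProg)
  | unload
  | done
  | free
  | track (r : ℕ) (up : Bool)
  | tail
  | any
  deriving Encodable

/-- The effect of an operation on a counter that follows the register `r`, or the difference
between the bound and the register `r`. -/
def effect (r : ℕ) (up : Bool) : CounterOp → SignType
  | .nop => 0
  | .inc s => if s = r then (if up then 1 else -1) else 0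
  | .dec s => if s = r then (if up then -1 else 1) else 0
  | .zero _ => 0

/-- The transitions that do not depend on the input. -/
inductive FixedTrans (P : CounterProg) (k : ℕ) : State → Letter → SignType → State → Prop
  | start_free (b : Bool) : FixedTrans P k (.start b) .load 0 .free
  | start_up (b : Bool) (r : ℕ) (h : r < k) : FixedTrans P k (.start b) .load 0 (.track r true)
  | start_down (b : Bool) (r : ℕ) (h : r < k) : FixedTrans P k (.start b) .load 1 (.track r false)
  | start_load : FixedTrans P k (.start true) .load 1 .load
  | load : FixedTrans P k .load .load 1 .load
  | chain : FixedTrans P k (.chain 0) (.op .nop) 0 (.ctl [P])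
  | ctl (q q' : List CounterProg) (o : CounterOp) (h : (q, o, q') ∈ P.edges) :
      FixedTrans P k (.ctl q) (.op o) 0 (.ctl q')
  | ctl_unload : FixedTrans P k (.ctl []) .unload (-1) .unload
  | unload : FixedTrans P k .unload .unload (-1) .unload
  | unload_halt : FixedTrans P k .unload .halt 0 .done
  | free (a : Letter) (h : a.Used k) (h' : a ≠ .halt) : FixedTrans P k .free a 0 .free
  | up_load (r : ℕ) (h : r < k) : FixedTrans P k (.track r true) .load 0 (.track r true)
  | down_load (r : ℕ) (h : r < k) : FixedTrans P k (.track r false) .load 1 (.track r false)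
  | track (r : ℕ) (up : Bool) (o : CounterOp) (h : r < k) (ho : o.Below k) :
      FixedTrans P k (.track r up) (.op o) (effect r up o) (.track r up)
  | track_tail (r : ℕ) (up : Bool) (o : CounterOp) (h : r < k) (ho : o.Below k) :
      FixedTrans P k (.track r up) (.op o) (effect r up o) .tail
  | track_zero (r : ℕ) (h : r < k) : FixedTrans P k (.track r true) (.op (.zero r)) (-1) .any
  | tail_op (o : CounterOp) (ho : o.Below k) : FixedTrans P k .tail (.op o) 0 .tail
  | tail_unload : FixedTrans P k .tail .unload (-1) .tail
  | tail_halt : FixedTrans P k .tail .halt (-1) .any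
  | any (a : Letter) (h : a.Used k) : FixedTrans P k .any a 0 .any

/-- The transitions of the net for the program `P` and the input `n`. -/
inductive Trans (P : CounterProg) (k n : ℕ) : State → Letter → SignType → State → Prop
  | fixed {s a d t} (h : FixedTrans P k s a d t) : Trans P k n s a d t
  | enter : Trans P k n .load (.op .nop) 0 (.chain n)
  | chain (j : ℕ) (h : j < n) : Trans P k n (.chain (j + 1)) (.op (.inc 0)) 0 (.chain j)

/-- The traces of a configuration. -/
def traces (P : CounterProg) (k n : ℕ) (s : State) (m : ℕ) : Set (List Letter) :=
  strongTraces (NetStep (Trans P k n)) (s, m)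

variable {P : CounterProg} {k n : ℕ}

/-! ### Traces of the error-detecting states -/

theorem cons_mem_traces {s : State} {m : ℕ} {a : Letter} {w : List Letter} :
    a :: w ∈ traces P k n s m ↔
      ∃ d t, ∃ m' : ℕ, Trans P k n s a d t ∧ (m' : ℤ) = (m : ℤ) + (d : ℤ) ∧ w ∈ traces P k n t m' := by
  rw [traces, cons_mem_strongTraces]
  constructor
  · rintro ⟨⟨t, m'⟩, ⟨d, h, hm⟩, hw⟩
    exact ⟨d, t, m', h, hm, hw⟩
  · rintro ⟨d, t, m', h, hm, hw⟩
    exact ⟨(t, m'), ⟨d, h, hm⟩, hw⟩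

theorem cons_mem_traces_of_fixed {s t : State} {m m' : ℕ} {a : Letter} {w : List Letter}
    {d : SignType} (h : FixedTrans P k s a d t) (hm : (m' : ℤ) = (m : ℤ) + (d : ℤ))
    (hw : w ∈ traces P k n t m') : a :: w ∈ traces P k n s m :=
  cons_mem_traces.2 ⟨d, t, m', .fixed h, hm, hw⟩

theorem used_of_trans (hk : 0 < k) (hP : ∀ t ∈ P.edges, t.2.1.Below k) {s t : State} {a : Letter}
    {d : SignType} (h : Trans P k n s a d t) : a.Used k := by
  cases h with
  | fixed h =>
    cases h <;> first
      | trivial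
      | assumption
      | exact hP _ ‹_›
  | enter => trivial
  | chain => exact hk

theorem used_of_mem_traces (hk : 0 < k) (hP : ∀ t ∈ P.edges, t.2.1.Below k) {w : List Letter}
    {s : State} {m : ℕ} (h : w ∈ traces P k n s m) : ∀ a ∈ w, a.Used k := by
  induction w generalizing s m with
  | nil => simp
  | cons a w ih =>
    obtain ⟨d, t, m', ht, -, hw⟩ := cons_mem_traces.1 h
    exact List.forall_mem_cons.2 ⟨used_of_trans hk hP ht, ih hw⟩

theorem mem_traces_any {w : List Letter} (h : ∀ a ∈ w, a.Used k) (m : ℕ) :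
    w ∈ traces P k n .any m := by
  induction w with
  | nil => exact nil_mem_strongTraces
  | cons a w ih =>
    rw [List.forall_mem_cons] at h
    exact cons_mem_traces_of_fixed (.any a h.1) (by simp) (ih h.2)

theorem mem_traces_free {w : List Letter} (h : ∀ a ∈ w, a.Used k) (hs : Letter.halt ∉ w) (m : ℕ) :
    w ∈ traces P k n .free m := by
  induction w with
  | nil => exact nil_mem_strongTraces
  | cons a w ih =>
    rw [List.forall_mem_cons] at h
    rw [List.mem_cons, not_or] at hs
    exact cons_mem_traces_of_fixed (.free a h.1 (Ne.symm hs.1)) (by simp) (ih h.2 hs.2)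

theorem halt_notMem_of_mem_traces_free {w : List Letter} {m : ℕ}
    (h : w ∈ traces P k n .free m) : Letter.halt ∉ w := by
  induction w generalizing m with
  | nil => simp
  | cons a w ih =>
    obtain ⟨d, t, m', ht, -, hw⟩ := cons_mem_traces.1 h
    cases ht with
    | fixed ht =>
      cases ht with
      | free _ _ h' => exact List.not_mem_cons_of_ne_of_not_mem (Ne.symm h') (ih hw)

/-- The final part of a complete execution. -/
def finish (b : ℕ) : List Letter := List.replicate b .unload ++ [.halt]

theorem used_map_op_append_finish {v : List CounterOp} (hv : ∀ o ∈ v, o.Below k) (b : ℕ) :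
    ∀ a ∈ v.map Letter.op ++ finish b, a.Used k := by
  intro a ha
  simp only [finish, List.mem_append, List.mem_map, List.mem_replicate, List.mem_singleton] at ha
  rcases ha with ⟨o, ho, rfl⟩ | ⟨-, rfl⟩ | rfl
  · exact hv o ho
  · trivial
  · trivial

theorem finish_mem_traces_tail_iff (b c : ℕ) : finish b ∈ traces P k n .tail c ↔ b < c := by
  induction b generalizing c with
  | zero =>
    constructor
    · intro h
      obtain ⟨d, t, m', ht, hm, -⟩ := cons_mem_traces.1 h
      cases ht with
      | fixed ht =>
        cases ht
        simp at hm
        omega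
    · intro h
      exact cons_mem_traces_of_fixed (m' := c - 1) .tail_halt (by simp; omega)
        nil_mem_strongTraces
  | succ b ih =>
    constructor
    · intro h
      obtain ⟨d, t, m', ht, hm, hw⟩ := cons_mem_traces.1 h
      cases ht with
      | fixed ht =>
        cases ht
        have := (ih m').1 hw
        simp at hm
        omega
    · intro h
      exact cons_mem_traces_of_fixed (m' := c - 1) .tail_unload (by simp; omega)
        ((ih _).2 (by omega))

/-- In `tail` operations leave the counter alone, while each of the `b` unloads and the final `halt`
costs one unit. Hence the strict inequality. -/
theorem mem_traces_tail_iff {v : List CounterOp} (hv : ∀ o ∈ v, o.Below k) (b c : ℕ) :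
    v.map Letter.op ++ finish b ∈ traces P k n .tail c ↔ b < c := by
  induction v with
  | nil => exact finish_mem_traces_tail_iff b c
  | cons o v ih =>
    rw [List.forall_mem_cons] at hv
    rw [← ih hv.2]
    constructor
    · intro h
      obtain ⟨d, t, m', ht, hm, hw⟩ := cons_mem_traces.1 h
      cases ht with
      | fixed ht =>
        cases ht
        obtain rfl : m' = c := by simpa using hm
        exact hw
    · exact fun h => cons_mem_traces_of_fixed (.tail_op o hv.1) (by simp) h

/-- The value of a counter that follows the register `r`, for the store `x` and the bound `K`. -/
def tracked (K : ℕ) (x : ℕ → ℕ) (r : ℕ) (up : Bool) : ℕ := if up then x r else K - x r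

/-- The bounds on both stores keep the truncated subtraction `K - x r` exact. -/
theorem tracked_step {K : ℕ} {x y : ℕ → ℕ} {o : CounterOp} (h : CounterOp.Step x o y)
    (hx : ∀ r, x r ≤ K) (hy : ∀ r, y r ≤ K) (r : ℕ) (up : Bool) :
    (tracked K y r up : ℤ) = (tracked K x r up : ℤ) + (effect r up o : ℤ) := by
  have hxr := hx r
  have hyr := hy r
  cases o with
  | nop => obtain rfl : y = x := h; simp [effect]
  | zero s => obtain rfl : y = x := h.2; simp [effect]
  | inc s =>
    obtain rfl : y = _ := h
    by_cases hs : s = r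
    · subst hs
      rw [Function.update_self] at hyr
      cases up <;> simp [effect, tracked]; omega
    · cases up <;> simp [effect, tracked, hs, Ne.symm hs]
  | dec s =>
    obtain ⟨h0, rfl⟩ := h
    by_cases hs : s = r
    · subst hs
      cases up <;> simp [effect, tracked] <;> omega
    · cases up <;> simp [effect, tracked, hs, Ne.symm hs]

/-- Every word of operations that cannot be executed within the bound is detected. -/
theorem exists_mem_traces_track {K b : ℕ} (hb : b ≤ K) {v : List CounterOp}
    (hv : ∀ o ∈ v, o.Below k) {x : ℕ → ℕ} (hx : ∀ r, x r ≤ K)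
    (h : ¬ ∃ y, LTSRun CounterOp.Step x v y) :
    ∃ r < k, ∃ up, v.map Letter.op ++ finish b ∈
      traces P k n (.track r up) (tracked K x r up) := by
  induction v generalizing x with
  | nil => exact absurd ⟨x, rfl⟩ h
  | cons o v ih =>
    rw [List.forall_mem_cons] at hv
    have hstep : ∀ y, CounterOp.Step x o y → (∀ r, y r ≤ K) → ∃ r < k, ∃ up,
        (o :: v).map Letter.op ++ finish b ∈ traces P k n (.track r up) (tracked K x r up) := by
      intro y hy hyK
      obtain ⟨r, hr, up, hw⟩ := ih hv.2 hyK fun ⟨z, hz⟩ => h ⟨z, y, hy, hz⟩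
      exact ⟨r, hr, up, cons_mem_traces_of_fixed (.track r up o hr hv.1)
        (tracked_step hy hx hyK r up) hw⟩
    -- An overflow to `K + 1` outlasts any `b ≤ K` unloads.
    have htail : v.map Letter.op ++ finish b ∈ traces P k n .tail (K + 1) :=
      (mem_traces_tail_iff hv.2 b _).2 (by omega)
    cases o with
    | nop => exact hstep x rfl hx
    | zero r =>
      by_cases hr : x r = 0
      · exact hstep x ⟨hr, rfl⟩ hx
      -- The false zero test is exposed by the decrement to `any`, possible since `x r` is positive.
      · refine ⟨r, hv.1, true, cons_mem_traces_of_fixed (m' := x r - 1) (.track_zero r hv.1) ?_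
          (mem_traces_any (used_map_op_append_finish hv.2 b) _)⟩
        simp [tracked]
        omega
    | dec r =>
      by_cases hr : x r = 0
      · refine ⟨r, hv.1, false, cons_mem_traces_of_fixed (.track_tail r _ _ hv.1 hv.1) ?_ htail⟩
        simp [tracked, effect, hr]
      · refine hstep _ ⟨hr, rfl⟩ fun s => ?_
        rw [Function.update_apply]
        have := hx s
        have := hx r
        split_ifs <;> omega
    | inc r =>
      by_cases hr : x r = K
      · refine ⟨r, hv.1, true, cons_mem_traces_of_fixed (.track_tail r _ _ hv.1 hv.1) ?_ htail⟩
        simp [tracked, effect, hr]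
      · refine hstep _ rfl fun s => ?_
        rw [Function.update_apply]
        have := hx s
        have := hx r
        split_ifs <;> omega

/-- A word of operations that can be executed within the bound is not detected. -/
theorem notMem_traces_track {K : ℕ} {v : List CounterOp} (hv : ∀ o ∈ v, o.Below k) {x y : ℕ → ℕ}
    (hx : ∀ r, x r + v.length ≤ K) (h : LTSRun CounterOp.Step x v y) (r : ℕ) (up : Bool) :
    v.map Letter.op ++ finish K ∉ traces P k n (.track r up) (tracked K x r up) := by
  induction v generalizing x with
  | nil =>
    intro hw
    rcases K with _ | K <;> obtain ⟨d, t, m', ht, -⟩ := cons_mem_traces.1 hw <;>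
    · cases ht with
      | fixed ht => cases ht
  | cons o v ih =>
    rw [List.forall_mem_cons] at hv
    obtain ⟨z, hz, h⟩ := h
    simp only [List.length_cons] at hx
    -- An operation raises a register by at most one and uses up one letter, so all registers stay
    -- within `K`.
    have hzK : ∀ r, z r + v.length ≤ K := by
      intro s
      have := hx s
      cases o with
      | nop => obtain rfl : z = x := hz; omega
      | zero t => obtain rfl : z = x := hz.2; omega
      | inc t =>
        obtain rfl : z = _ := hz
        rw [Function.update_apply]
        split_ifs with hs
        · subst hs; omega
        · omega
      | dec t =>
        obtain ⟨-, rfl⟩ := hz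
        rw [Function.update_apply]
        split_ifs with hs
        · subst hs; omega
        · omega
    have htr := tracked_step hz (K := K) (fun s => by have := hx s; omega)
      (fun s => by have := hzK s; omega) r up
    intro hw
    obtain ⟨d, t, m', ht, hm, hw⟩ := cons_mem_traces.1 hw
    cases ht with
    | fixed ht =>
      cases ht with
      | track =>
        rw [← htr] at hm
        rw [Nat.cast_injective hm] at hw
        exact ih hv.2 hzK h hw
      | track_tail =>
        rw [← htr] at hm
        rw [Nat.cast_injective hm] at hw
        -- A claimed overflow needs a tracked value above `K`, but both `z r` and `K - z r` are at
        -- most `K`.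
        have hlt := (mem_traces_tail_iff hv.2 K _).1 hw
        have := hzK r
        cases up <;> simp [tracked] at hlt <;> omega
      | track_zero =>
        have h0 : x r = 0 := hz.1
        simp [tracked, h0] at hm

theorem replicate_load_mem_traces_up {r c a : ℕ} (hr : r < k) {w : List Letter} :
    List.replicate a .load ++ w ∈ traces P k n (.track r true) c ↔
      w ∈ traces P k n (.track r true) c := by
  induction a with
  | zero => rfl
  | succ a ih =>
    rw [← ih]
    constructor
    · intro h
      obtain ⟨d, t, m', ht, hm, hw⟩ := cons_mem_traces.1 h
      cases ht with
      | fixed ht =>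
        cases ht
        obtain rfl : m' = c := by simpa using hm
        exact hw
    · exact fun h => cons_mem_traces_of_fixed (.up_load r hr) (by simp) h

theorem replicate_load_mem_traces_down {r c a : ℕ} (hr : r < k) {w : List Letter} :
    List.replicate a .load ++ w ∈ traces P k n (.track r false) c ↔
      w ∈ traces P k n (.track r false) (c + a) := by
  induction a generalizing c with
  | zero => rfl
  | succ a ih =>
    rw [← Nat.add_assoc, Nat.add_right_comm, ← ih]
    constructor
    · intro h
      obtain ⟨d, t, m', ht, hm, hw⟩ := cons_mem_traces.1 h
      cases ht with
      | fixed ht =>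
        cases ht
        obtain rfl : m' = c + 1 := by
          have : (m' : ℤ) = c + 1 := by simpa using hm
          omega
        exact hw
    · exact fun h => cons_mem_traces_of_fixed (.down_load r hr) (by simp) h

/-! #### The executions generated by the left process -/

theorem traces_done {w : List Letter} {m : ℕ} (h : w ∈ traces P k n .done m) : w = [] := by
  cases w with
  | nil => rfl
  | cons a w =>
    obtain ⟨d, t, m', ht, -⟩ := cons_mem_traces.1 h
    cases ht with
    | fixed ht => cases ht

theorem finish_mem_traces_unload {b m : ℕ} (h : b ≤ m) : finish b ∈ traces P k n .unload m := by
  induction b generalizing m with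
  | zero => exact cons_mem_traces_of_fixed .unload_halt (m' := m) (by simp) nil_mem_strongTraces
  | succ b ih =>
    exact cons_mem_traces_of_fixed .unload (m' := m - 1) (by simp; omega) (ih (by omega))

theorem eq_finish_of_mem_traces_unload {w : List Letter} {m : ℕ}
    (h : w ∈ traces P k n .unload m) (hs : Letter.halt ∈ w) : ∃ b ≤ m, w = finish b := by
  induction w generalizing m with
  | nil => simp at hs
  | cons a w ih =>
    obtain ⟨d, t, m', ht, hm, hw⟩ := cons_mem_traces.1 h
    cases ht with
    | fixed ht =>
      cases ht with
      | unload =>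
        obtain ⟨b, hb, rfl⟩ := ih hw (by simpa using hs)
        simp at hm
        exact ⟨b + 1, by omega, rfl⟩
      | unload_halt =>
        obtain rfl := traces_done hw
        exact ⟨0, by omega, rfl⟩

theorem mem_traces_ctl {u : List CounterOp} {q : List CounterProg}
    (hu : LTSRun (fun s o t => (s, o, t) ∈ P.edges) q u []) {b m : ℕ} (hb : b + 1 ≤ m) :
    u.map Letter.op ++ finish (b + 1) ∈ traces P k n (.ctl q) m := by
  induction u generalizing q with
  | nil =>
    obtain rfl : q = [] := hu
    exact cons_mem_traces_of_fixed .ctl_unload (m' := m - 1) (by simp; omega)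
      (finish_mem_traces_unload (by omega))
  | cons o u ih =>
    obtain ⟨q', hq, hu⟩ := hu
    exact cons_mem_traces_of_fixed (.ctl q q' o hq) (by simp) (ih hu)

/-- The letter `halt` is available only in `unload`, which is entered only from the empty
continuation. So a trace containing it spells a complete run of the automaton. -/
theorem exists_of_mem_traces_ctl {w : List Letter} {q : List CounterProg} {m : ℕ}
    (h : w ∈ traces P k n (.ctl q) m) (hs : Letter.halt ∈ w) :
    ∃ u, LTSRun (fun s o t => (s, o, t) ∈ P.edges) q u [] ∧
      ∃ b ≤ m, w = u.map Letter.op ++ finish b := by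
  induction w generalizing q m with
  | nil => simp at hs
  | cons a w ih =>
    obtain ⟨d, t, m', ht, hm, hw⟩ := cons_mem_traces.1 h
    cases ht with
    | fixed ht =>
      cases ht with
      | ctl _ q' o hq =>
        obtain ⟨u, hu, b, hb, rfl⟩ := ih hw (by simpa using hs)
        simp at hm
        exact ⟨o :: u, ⟨q', hq, hu⟩, b, by omega, rfl⟩
      | ctl_unload =>
        obtain ⟨b, hb, rfl⟩ := eq_finish_of_mem_traces_unload hw (by simpa using hs)
        simp at hm
        exact ⟨[], rfl, b + 1, by omega, rfl⟩

/-- The operations of an execution after the increments of the input register. -/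
def input (n : ℕ) (u : List CounterOp) : List CounterOp :=
  List.replicate n (.inc 0) ++ .nop :: u

theorem mem_traces_chain {j m : ℕ} (hj : j ≤ n) {u : List CounterOp} {w : List Letter}
    (h : u.map Letter.op ++ w ∈ traces P k n (.ctl [P]) m) :
    (input j u).map Letter.op ++ w ∈ traces P k n (.chain j) m := by
  induction j with
  | zero => exact cons_mem_traces_of_fixed .chain (by simp) h
  | succ j ih =>
    exact cons_mem_traces.2 ⟨0, .chain j, m, .chain j hj, by simp, ih (by omega)⟩

theorem exists_of_mem_traces_chain {w : List Letter} {j m : ℕ}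
    (h : w ∈ traces P k n (.chain j) m) (hs : Letter.halt ∈ w) :
    ∃ u, LTSRun (fun s o t => (s, o, t) ∈ P.edges) [P] u [] ∧
      ∃ b ≤ m, w = (input j u).map Letter.op ++ finish b := by
  induction w generalizing j m with
  | nil => simp at hs
  | cons a w ih =>
    obtain ⟨d, t, m', ht, hm, hw⟩ := cons_mem_traces.1 h
    cases ht with
    | fixed ht =>
      cases ht
      obtain ⟨u, hu, b, hb, rfl⟩ := exists_of_mem_traces_ctl hw (by simpa using hs)
      simp at hm
      exact ⟨u, hu, b, by omega, rfl⟩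
    | chain j hj =>
      obtain ⟨u, hu, b, hb, rfl⟩ := ih hw (by simpa using hs)
      simp at hm
      exact ⟨u, hu, b, by omega, rfl⟩

theorem replicate_load_mem_traces_load {a m : ℕ} {w : List Letter}
    (h : w ∈ traces P k n .load (m + a)) :
    List.replicate a .load ++ w ∈ traces P k n .load m := by
  induction a generalizing m with
  | zero => exact h
  | succ a ih =>
    exact cons_mem_traces_of_fixed .load (m' := m + 1) (by simp)
      (ih (by rwa [Nat.add_assoc, Nat.add_comm 1]))

theorem exists_of_mem_traces_load {w : List Letter} {m : ℕ}
    (h : w ∈ traces P k n .load m) (hs : Letter.halt ∈ w) :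
    ∃ u, LTSRun (fun s o t => (s, o, t) ∈ P.edges) [P] u [] ∧ ∃ a, ∃ b ≤ m + a,
      w = List.replicate a .load ++ ((.nop :: input n u).map Letter.op ++ finish b) := by
  induction w generalizing m with
  | nil => simp at hs
  | cons a w ih =>
    obtain ⟨d, t, m', ht, hm, hw⟩ := cons_mem_traces.1 h
    cases ht with
    | fixed ht =>
      cases ht
      obtain ⟨u, hu, a, b, hb, rfl⟩ := ih hw (by simpa using hs)
      simp at hm
      exact ⟨u, hu, a + 1, b, by omega, rfl⟩
    | enter =>
      obtain ⟨u, hu, b, hb, rfl⟩ := exists_of_mem_traces_chain hw (by simpa using hs)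
      simp at hm
      exact ⟨u, hu, 0, b, by omega, rfl⟩

/-! #### Comparison of the two processes -/

/-- Every initial transition of `start false` is also one of `start true`, with the same target;
this reduces equivalence to inclusion. -/
theorem traces_right_subset_left :
    traces P k n (.start false) 0 ⊆ traces P k n (.start true) 0 := by
  rintro (_ | ⟨a, w⟩) h
  · exact nil_mem_strongTraces
  · obtain ⟨d, t, m', ht, hm, hw⟩ := cons_mem_traces.1 h
    cases ht with
    | fixed ht =>
      cases ht with
      | start_free => exact cons_mem_traces_of_fixed (.start_free _) hm hw
      | start_up _ r hr => exact cons_mem_traces_of_fixed (.start_up _ r hr) hm hw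
      | start_down _ r hr => exact cons_mem_traces_of_fixed (.start_down _ r hr) hm hw

theorem below_of_run (hP : ∀ t ∈ P.edges, t.2.1.Below k) {q : List CounterProg}
    {u : List CounterOp} (hu : LTSRun (fun s o t => (s, o, t) ∈ P.edges) q u []) :
    ∀ o ∈ u, o.Below k := by
  induction u generalizing q with
  | nil => simp
  | cons o u ih =>
    obtain ⟨q', hq, hu⟩ := hu
    exact List.forall_mem_cons.2 ⟨hP _ hq, ih hu⟩

theorem below_input (hk : 0 < k) {u : List CounterOp} (hu : ∀ o ∈ u, o.Below k) :
    ∀ o ∈ CounterOp.nop :: input n u, o.Below k := by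
  intro o ho
  simp only [input, List.mem_cons, List.mem_append, List.mem_replicate] at ho
  rcases ho with rfl | ⟨-, rfl⟩ | rfl | ho
  · trivial
  · exact hk
  · trivial
  · exact hu o ho

/-- The core of the reduction: a left trace escapes the right process exactly if its operations form
a valid terminating execution with a sufficient bound. -/
theorem traces_left_subset_right_iff (hk : 0 < k) (hP : ∀ t ∈ P.edges, t.2.1.Below k) :
    traces P k n (.start true) 0 ⊆ traces P k n (.start false) 0 ↔
      ¬ ∃ y, P.Rel (Function.update (fun _ => 0) 0 n) y := by
  have hrel : (∃ y, P.Rel (Function.update (fun _ => 0) 0 n) y) ↔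
      ∃ u, LTSRun (fun s o t => (s, o, t) ∈ P.edges) [P] u [] ∧
        ∃ y, LTSRun CounterOp.Step (fun _ => 0) (.nop :: input n u) y := by
    have hinput : ∀ u y, LTSRun CounterOp.Step (fun _ => 0) (.nop :: input n u) y ↔
        LTSRun CounterOp.Step (Function.update (fun _ => 0) 0 n) u y := by
      intro u y
      constructor
      · rintro ⟨x, rfl, h⟩
        obtain ⟨z, rfl, h⟩ := (CounterProg.run_replicate_inc n _ y _).1 h
        simpa using h
      · intro h
        exact ⟨_, rfl, (CounterProg.run_replicate_inc n _ y _).2 ⟨_, rfl, by simpa using h⟩⟩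
    simp only [CounterProg.rel_iff_exists_run, CounterProg.run_edges_iff, hinput]
    exact ⟨fun ⟨y, u, hu, hy⟩ => ⟨u, hu, y, hy⟩, fun ⟨u, hu, y, hy⟩ => ⟨y, u, hu, hy⟩⟩
  rw [hrel]
  constructor
  · rintro hsub ⟨u, hu, y, hy⟩
    set v := CounterOp.nop :: input n u with hv
    have hbelow : ∀ o ∈ v, o.Below k := below_input hk (below_of_run hP hu)
    -- Registers start at zero, so the length bounds them throughout. The mandatory first `load`
    -- makes the actual bound `K + 1`.
    set K := v.length with hK
    have hw : .load :: (List.replicate K .load ++ (v.map Letter.op ++ finish (K + 1))) ∈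
        traces P k n (.start true) 0 := by
      refine cons_mem_traces_of_fixed .start_load (m' := 1) (by simp)
        (replicate_load_mem_traces_load (cons_mem_traces.2
          ⟨0, .chain n, 1 + K, .enter, by simp, mem_traces_chain le_rfl (mem_traces_ctl hu ?_)⟩))
      omega
    obtain ⟨d, t, m', ht, hm, hw⟩ := cons_mem_traces.1 (hsub hw)
    have hdet := notMem_traces_track (P := P) (n := n) hbelow (x := fun _ => 0) (K := K + 1)
      (fun r => by omega) hy
    cases ht with
    | fixed ht =>
      cases ht with
      | start_free => exact halt_notMem_of_mem_traces_free hw (by simp [finish])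
      | start_up _ r hr =>
        obtain rfl : m' = 0 := by simpa using hm
        exact hdet r true ((replicate_load_mem_traces_up hr).1 hw)
      | start_down _ r hr =>
        obtain rfl : m' = 1 := by
          have : (m' : ℤ) = 1 := by simpa using hm
          omega
        refine hdet r false ?_
        have := (replicate_load_mem_traces_down hr).1 hw
        rwa [Nat.add_comm] at this
  · rintro hno (_ | ⟨a, w⟩) h
    · exact nil_mem_strongTraces
    · have hused := used_of_mem_traces hk hP h
      obtain ⟨d, t, m', ht, hm, hw⟩ := cons_mem_traces.1 h
      cases ht with
      | fixed ht =>
        cases ht with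
        | start_free => exact cons_mem_traces_of_fixed (.start_free _) hm hw
        | start_up _ r hr => exact cons_mem_traces_of_fixed (.start_up _ r hr) hm hw
        | start_down _ r hr => exact cons_mem_traces_of_fixed (.start_down _ r hr) hm hw
        | start_load =>
          -- Incomplete words are absorbed by `free`, so only words with `halt` need an error
          -- detected.
          by_cases hs : Letter.halt ∈ w
          · obtain ⟨u, hu, a, b, hb, rfl⟩ := exists_of_mem_traces_load hw hs
            obtain rfl : m' = 1 := by
              have : (m' : ℤ) = 1 := by simpa using hm
              omega
            obtain ⟨r, hr, up, hdet⟩ := exists_mem_traces_track (P := P) (n := n) hb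
              (below_input hk (below_of_run hP hu)) (x := fun _ => 0) (fun r => by omega)
              fun hy => hno ⟨u, hu, hy⟩
            cases up with
            | true =>
              exact cons_mem_traces_of_fixed (.start_up _ r hr) (m' := 0) (by simp)
                ((replicate_load_mem_traces_up hr).2 hdet)
            | false =>
              exact cons_mem_traces_of_fixed (.start_down _ r hr) (m' := 1) (by simp)
                ((replicate_load_mem_traces_down hr).2 hdet)
          · exact cons_mem_traces_of_fixed (.start_free _) (m' := 0) (by simp)
              (mem_traces_free (List.forall_mem_cons.1 hused).2 hs 0)

end ProgramNet

/-! ### Instances of the trace problems -/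

/-! ### Transfer of traces to numbered instances -/

theorem weakTraces_eq_strongTraces {V Act : Type*} {τ : Act} {step : V → Act → V → Prop}
    (h : ∀ x y, ¬ step x τ y) (s : V) : weakTraces τ step s = strongTraces step s := by
  have hrefl : ∀ x y, Relation.ReflTransGen (fun x y => step x τ y) x y → x = y := by
    intro x y hxy
    rcases Relation.ReflTransGen.cases_head hxy with rfl | ⟨z, hz, -⟩
    · rfl
    · exact absurd hz (h _ _)
  have hstep : ∀ x y a, a ≠ τ → (weakStep τ step x a y ↔ step x a y) := by
    intro x y a ha
    constructor
    · rintro (⟨rfl, -⟩ | ⟨-, u, v, hu, huv, hv⟩)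
      · exact absurd rfl ha
      · rwa [hrefl _ _ hu, ← hrefl _ _ hv]
    · exact fun hxy => .inr ⟨ha, x, y, .refl, hxy, .refl⟩
  have hrun : ∀ (w : List Act) (x y : V), τ ∉ w →
      (LTSRun (weakStep τ step) x w y ↔ LTSRun step x w y) := by
    intro w
    induction w with
    | nil => exact fun x y _ => Iff.rfl
    | cons a w ih =>
      intro x y hw
      rw [List.mem_cons, not_or] at hw
      exact exists_congr fun u => and_congr (hstep x u a (Ne.symm hw.1)) (ih u y hw.2)
  have hτ : ∀ (w : List Act) (x y : V), LTSRun step x w y → τ ∉ w := by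
    intro w
    induction w with
    | nil => simp
    | cons a w ih =>
      rintro x y ⟨u, hu, hw⟩ hmem
      rcases List.mem_cons.1 hmem with rfl | hmem
      · exact h _ _ hu
      · exact ih u y hw hmem
  ext w
  constructor
  · rintro ⟨hw, y, hy⟩
    exact ⟨y, (hrun w s y hw).1 hy⟩
  · rintro ⟨y, hy⟩
    exact ⟨hτ w s y hy, y, (hrun w s y (hτ w s y hy)).2 hy⟩

namespace OCNInstance

/-- The transitions of the instance are the images of those of `T` under the numberings `eS` of
control states and `eA` of actions. -/
def Encodes {S A : Type*} (I : OCNInstance) (T : S → A → SignType → S → Prop) (eS : S → ℕ)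
    (eA : A → ℕ) : Prop :=
  ∀ p a d q, (p, a, d, q) ∈ I.transitions ↔ ∃ s b t, T s b d t ∧ eS s = p ∧ eA b = a ∧ eS t = q

variable {S A : Type*} {I : OCNInstance} {T : S → A → SignType → S → Prop} {eS : S → ℕ}
  {eA : A → ℕ}

theorem step_iff (c c' : Fin I.numStates × ℕ) (a : Fin I.numActions) :
    I.net.Step c a c' ↔ ∃ d : SignType, ((c.1 : ℕ), (a : ℕ), d, (c'.1 : ℕ)) ∈ I.transitions ∧
      (c'.2 : ℤ) = (c.2 : ℤ) + (d : ℤ) := by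
  constructor
  · rintro (h | ⟨d, h, -⟩)
    · exact h
    · exact h.elim
  · exact fun h => .inl h

theorem Encodes.mem_strongTraces_iff (h : I.Encodes T eS eA) (hS : Function.Injective eS)
    (w : List (Fin I.numActions)) (p : Fin I.numStates) (s : S) (m : ℕ) (hp : eS s = p) :
    w ∈ strongTraces I.net.Step (p, m) ↔
      ∃ v ∈ strongTraces (NetStep T) (s, m), v.map eA = w.map Fin.val := by
  induction w generalizing p s m with
  | nil => exact ⟨fun _ => ⟨[], nil_mem_strongTraces, rfl⟩, fun _ => nil_mem_strongTraces⟩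
  | cons a w ih =>
    constructor
    · intro hw
      obtain ⟨⟨q, m'⟩, hstep, hw⟩ := cons_mem_strongTraces.1 hw
      obtain ⟨d, hd, hm⟩ := (step_iff _ _ _).1 hstep
      obtain ⟨s', b, t, hT, hs, hb, ht⟩ := (h _ _ _ _).1 hd
      obtain rfl : s' = s := hS (hs.trans hp.symm)
      obtain ⟨v, hv, hvw⟩ := (ih q t m' ht).1 hw
      refine ⟨b :: v, cons_mem_strongTraces.2 ⟨(t, m'), ⟨d, hT, hm⟩, hv⟩, ?_⟩
      rw [List.map_cons, List.map_cons, hvw, hb]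
    · rintro ⟨_ | ⟨b, v⟩, hv, hvw⟩
      · simp at hvw
      · rw [List.map_cons, List.map_cons, List.cons.injEq] at hvw
        obtain ⟨⟨t, m'⟩, ⟨d, hT, hm⟩, hv⟩ := cons_mem_strongTraces.1 hv
        have hmem := (h p a d (eS t)).2 ⟨s, b, t, hT, hp, hvw.1, rfl⟩
        exact cons_mem_strongTraces.2 ⟨(⟨eS t, (I.transitions_lt _ hmem).2.2⟩, m'),
          (step_iff _ _ _).2 ⟨d, hmem, hm⟩, (ih _ t m' rfl).2 ⟨v, hv, hvw.2⟩⟩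

/-- The numbering of letters need not stay below `numActions`, but every letter on a trace labels a
listed transition and is therefore in range. -/
theorem Encodes.exists_word (h : I.Encodes T eS eA) (v : List A) (c : S × ℕ)
    (hv : v ∈ strongTraces (NetStep T) c) :
    ∃ w : List (Fin I.numActions), v.map eA = w.map Fin.val := by
  induction v generalizing c with
  | nil => exact ⟨[], rfl⟩
  | cons b v ih =>
    obtain ⟨c', ⟨d, hT, -⟩, hv⟩ := cons_mem_strongTraces.1 hv
    obtain ⟨w, hw⟩ := ih c' hv
    have hmem := (h _ _ d _).2 ⟨_, b, _, hT, rfl, rfl, rfl⟩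
    refine ⟨⟨eA b, (I.transitions_lt _ hmem).2.1⟩ :: w, ?_⟩
    rw [List.map_cons, List.map_cons, hw]

theorem Encodes.strongTraces_subset_iff (h : I.Encodes T eS eA) (hS : Function.Injective eS)
    (hA : Function.Injective eA) {p q : Fin I.numStates} {s t : S} (m n : ℕ) (hp : eS s = p)
    (hq : eS t = q) :
    strongTraces I.net.Step (p, m) ⊆ strongTraces I.net.Step (q, n) ↔
      strongTraces (NetStep T) (s, m) ⊆ strongTraces (NetStep T) (t, n) := by
  constructor
  · intro hsub v hv
    obtain ⟨w, hw⟩ := h.exists_word v _ hv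
    obtain ⟨v', hv', hvw⟩ := (h.mem_strongTraces_iff hS w q t n hq).1
      (hsub ((h.mem_strongTraces_iff hS w p s m hp).2 ⟨v, hv, hw⟩))
    rwa [← hA.list_map (hvw.trans hw.symm)]
  · intro hsub w hw
    obtain ⟨v, hv, hvw⟩ := (h.mem_strongTraces_iff hS w p s m hp).1 hw
    exact (h.mem_strongTraces_iff hS w q t n hq).2 ⟨v, hsub hv, hvw⟩

/-- Instances form a computable family if their data do. -/
theorem computable_of_rawData {f : ℕ → OCNInstance}
    (hf : Primrec fun n => (equivRawData (f n)).1) : Computable f := by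
  have h : Primrec fun n => equivRawData (f n) := Primrec.subtype_val_iff.1 hf
  have h' : Primrec fun n => equivRawData.symm (equivRawData (f n)) :=
    (Primrec.of_equiv_symm (e := equivRawData)).comp h
  simpa using h'.to_comp

end OCNInstance

namespace ProgramNet

/-! ### Finiteness and numbering of the net -/

theorem finite_below (k : ℕ) : {o : CounterOp | o.Below k}.Finite := by
  refine ((Set.finite_singleton CounterOp.nop).union (((Set.finite_Iio k).image .inc).union
    (((Set.finite_Iio k).image .dec).union ((Set.finite_Iio k).image .zero)))).subset ?_
  rintro (_ | r | r | r) h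
  · exact .inl rfl
  · exact .inr (.inl ⟨r, h, rfl⟩)
  · exact .inr (.inr (.inl ⟨r, h, rfl⟩))
  · exact .inr (.inr (.inr ⟨r, h, rfl⟩))

theorem finite_used (k : ℕ) : {a : Letter | a.Used k}.Finite := by
  refine ((Set.toFinite {Letter.load, Letter.unload, Letter.halt}).union
    ((finite_below k).image .op)).subset ?_
  rintro (_ | _ | o | _ | _) h
  · exact h.elim
  · exact .inl (by simp)
  · exact .inr ⟨o, h, rfl⟩
  · exact .inl (by simp)
  · exact .inl (by simp)

/-- The control states that occur in the transitions that do not depend on the input. -/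
def fixedStates (P : CounterProg) (k : ℕ) : Set State :=
  {.start true, .start false, .load, .chain 0, .unload, .done, .free, .tail, .any} ∪
    (State.ctl '' insert [] (P.stackSet []) ∪ Set.image2 State.track (Set.Iio k) Set.univ)

theorem finite_fixedStates (P : CounterProg) (k : ℕ) : (fixedStates P k).Finite :=
  (Set.toFinite _).union (((((CounterProg.finite_stackSet P []).insert []).image _)).union
    (Set.Finite.image2 _ (Set.finite_Iio k) Set.finite_univ))

theorem finite_fixedTrans {P : CounterProg} {k : ℕ} (hk : 0 < k)
    (hP : ∀ t ∈ P.edges, t.2.1.Below k) :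
    {t : State × Letter × SignType × State | FixedTrans P k t.1 t.2.1 t.2.2.1 t.2.2.2}.Finite := by
  refine ((finite_fixedStates P k).prod ((finite_used k).prod
    (Set.finite_univ.prod (finite_fixedStates P k)))).subset ?_
  rintro ⟨s, a, d, t⟩ h
  have hctl : ∀ q ∈ P.stackSet [], State.ctl q ∈ fixedStates P k := fun q hq =>
    .inr (.inl ⟨q, .inr hq, rfl⟩)
  have hnil : State.ctl [] ∈ fixedStates P k := .inr (.inl ⟨[], .inl rfl, rfl⟩)
  have htrack : ∀ r up, r < k → State.track r up ∈ fixedStates P k := fun r up hr =>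
    .inr (.inr ⟨r, hr, up, trivial, rfl⟩)
  have hstart : ∀ b, State.start b ∈ fixedStates P k := fun b => .inl (by cases b <;> simp)
  refine ⟨?_, used_of_trans (n := 0) hk hP (.fixed h), trivial, ?_⟩
  · change FixedTrans P k s a d t at h
    change s ∈ fixedStates P k
    cases h with
    | ctl q q' o hq => exact hctl q hq.1
    | _ => first
      | exact hnil
      | exact hstart _
      | exact htrack _ _ ‹_›
      | exact .inl (by simp)
  · change FixedTrans P k s a d t at h
    change t ∈ fixedStates P k
    cases h with
    | ctl q q' o hq =>
      rcases CounterProg.mem_stackSet_of_edge P [] hq.1 hq.2 with h | rfl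
      · exact hctl q' h
      · exact hnil
    | chain => exact hctl _ (CounterProg.cons_mem_stackSet P [])
    | _ => first
      | exact htrack _ _ ‹_›
      | exact .inl (by simp)

/-- The numbering of the control states. -/
def stateCode : State → ℕ
  | .chain j => 2 * j + 1
  | s => 2 * Encodable.encode s

/-- Odd codes are reserved for the chain states, the only ones that grow with the input; their
explicit form makes `inputTrans` primitive recursive. -/
theorem stateCode_injective : Function.Injective stateCode := by
  intro s t h
  have hcase : ∀ s : State, (∃ j, s = .chain j) ∨ stateCode s = 2 * Encodable.encode s := by
    intro s
    cases s <;> first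
      | exact .inl ⟨_, rfl⟩
      | exact .inr rfl
  have hchain : ∀ j, stateCode (.chain j) = 2 * j + 1 := fun _ => rfl
  rcases hcase s with ⟨i, rfl⟩ | hs <;> rcases hcase t with ⟨j, rfl⟩ | ht
  · rw [hchain, hchain] at h
    congr 1
    omega
  · rw [hchain, ht] at h
    omega
  · rw [hchain, hs] at h
    omega
  · rw [hs, ht] at h
    exact Encodable.encode_injective (by omega)

/-- The number of a transition. -/
def transCode (t : State × Letter × SignType × State) : ℕ × ℕ × SignType × ℕ :=
  (stateCode t.1, Encodable.encode t.2.1, t.2.2.1, stateCode t.2.2.2)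

/-- The transitions that depend on the input `n`. -/
def inputTrans (n : ℕ) : List (ℕ × ℕ × SignType × ℕ) :=
  (stateCode .load, Encodable.encode (Letter.op .nop), 0, 2 * n + 1) ::
    (List.range n).map fun j =>
      (2 * j + 3, Encodable.encode (Letter.op (.inc 0)), 0, 2 * j + 1)

theorem primrec_inputTrans : Primrec inputTrans := by
  have hlin : ∀ c, Primrec fun j : ℕ => 2 * j + c := fun c =>
    Primrec.nat_add.comp (Primrec.nat_mul.comp (.const 2) .id) (.const c)
  refine Primrec.list_cons.comp
    ((Primrec.const _).pair ((Primrec.const _).pair ((Primrec.const _).pair (hlin 1)))) ?_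
  refine Primrec.list_map Primrec.list_range ?_
  exact ((hlin 3).comp .snd).pair ((Primrec.const _).pair ((Primrec.const _).pair
    ((hlin 1).comp .snd)))

/-- The nets of a program for all inputs form a computable family of instances. -/
theorem exists_instances {P : CounterProg} {k : ℕ} (hk : 0 < k)
    (hP : ∀ t ∈ P.edges, t.2.1.Below k) :
    ∃ f : ℕ → OCNInstance, Computable f ∧ ∀ n,
      (f n).Encodes (Trans P k n) stateCode Encodable.encode ∧
      (f n).τ = Encodable.encode Letter.tau ∧
      (f n).p = stateCode (.start true) ∧ (f n).m = 0 ∧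
      (f n).q = stateCode (.start false) ∧ (f n).n = 0 := by
  set L := ((finite_fixedTrans hk hP).toFinset.toList).map transCode with hL
  have hmemL : ∀ t, t ∈ L ↔ ∃ u : State × Letter × SignType × State,
      FixedTrans P k u.1 u.2.1 u.2.2.1 u.2.2.2 ∧ transCode u = t := by
    intro t
    simp only [hL, List.mem_map, Finset.mem_toList, Set.Finite.mem_toFinset, Set.mem_ofPred_eq]
  obtain ⟨B, hB⟩ := (List.finite_toSet
    ([stateCode .load, stateCode (.start true), stateCode (.start false),
      Encodable.encode Letter.tau, Encodable.encode (Letter.op .nop),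
      Encodable.encode (Letter.op (.inc 0))] ++
      L.flatMap fun t => [t.1, t.2.1, t.2.2.2])).bddAbove
  have hB' : ∀ x ∈ [stateCode .load, stateCode (.start true), stateCode (.start false),
      Encodable.encode Letter.tau, Encodable.encode (Letter.op .nop),
      Encodable.encode (Letter.op (.inc 0))], x ≤ B := fun x hx =>
    hB (List.mem_append_left _ hx)
  have hBL : ∀ t ∈ L, t.1 ≤ B ∧ t.2.1 ≤ B ∧ t.2.2.2 ≤ B := fun t ht =>
    ⟨hB (List.mem_append_right _ (List.mem_flatMap.2 ⟨t, ht, by simp⟩)),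
      hB (List.mem_append_right _ (List.mem_flatMap.2 ⟨t, ht, by simp⟩)),
      hB (List.mem_append_right _ (List.mem_flatMap.2 ⟨t, ht, by simp⟩))⟩
  simp only [List.forall_mem_cons] at hB'
  obtain ⟨hload, hleft, hright, htau, hnop, hinc, -⟩ := hB'
  let f : ℕ → OCNInstance := fun n =>
    { numStates := B + 2 * n + 2
      -- `B` bounds all codes independent of the input, and `2 * n + 1` is the largest chain code;
      -- the number of states exceeds both.
      numActions := B + 1
      τ := Encodable.encode Letter.tau
      transitions := L ++ inputTrans n
      p := stateCode (.start true)
      m := 0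
      q := stateCode (.start false)
      n := 0
      τ_lt := by omega
      p_lt := by omega
      q_lt := by omega
      transitions_lt := by
        intro t ht
        rcases List.mem_append.1 ht with ht | ht
        · have := hBL t ht
          omega
        · simp only [inputTrans, List.mem_cons, List.mem_map, List.mem_range] at ht
          rcases ht with rfl | ⟨j, hj, rfl⟩
          · exact ⟨by dsimp only; omega, by dsimp only; omega, by dsimp only; omega⟩
          · exact ⟨by dsimp only; omega, by dsimp only; omega, by dsimp only; omega⟩ }
  refine ⟨f, OCNInstance.computable_of_rawData ?_, fun n => ⟨?_, rfl, rfl, rfl, rfl, rfl⟩⟩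
  · have hlin : Primrec fun n : ℕ => B + 2 * n + 2 :=
      Primrec.nat_add.comp (Primrec.nat_add.comp (.const B)
        (Primrec.nat_mul.comp (.const 2) .id)) (.const 2)
    exact (hlin.pair ((Primrec.const _).pair ((Primrec.const _).pair
      (Primrec.list_append.comp (.const L) primrec_inputTrans)))).pair
      (.const ((stateCode (.start true), 0), (stateCode (.start false), 0)))
  · intro p a d q
    change (p, a, d, q) ∈ L ++ inputTrans n ↔ _
    rw [List.mem_append, hmemL]
    simp only [inputTrans, List.mem_cons, List.mem_map, List.mem_range]
    constructor
    · rintro (⟨⟨s, b, d', t⟩, h, he⟩ | he | ⟨j, hj, he⟩)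
      · simp only [transCode, Prod.mk.injEq] at he
        obtain ⟨rfl, rfl, rfl, rfl⟩ := he
        exact ⟨s, b, t, .fixed h, rfl, rfl, rfl⟩
      · simp only [Prod.mk.injEq] at he
        obtain ⟨rfl, rfl, rfl, rfl⟩ := he
        exact ⟨_, _, _, .enter, rfl, rfl, rfl⟩
      · simp only [Prod.mk.injEq] at he
        obtain ⟨rfl, rfl, rfl, rfl⟩ := he
        exact ⟨_, _, _, .chain j hj, rfl, rfl, rfl⟩
    · rintro ⟨s, b, t, h, rfl, rfl, rfl⟩
      cases h with
      | fixed h => exact .inl ⟨(s, b, d, t), h, rfl⟩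
      | enter => exact .inr (.inl rfl)
      | chain j hj => exact .inr (.inr ⟨j, hj, rfl⟩)

/-- For every program there is a computable family of instances for which each of the four trace
problems expresses that the program does not terminate. -/
theorem exists_reduction (P : CounterProg) :
    ∃ f : ℕ → OCNInstance, Computable f ∧ ∀ n,
      let halts := ∃ y, P.Rel (Function.update (fun _ => 0) 0 n) y
      ((f n).StrongTraceInclusion ↔ ¬ halts) ∧ ((f n).StrongTraceEquivalence ↔ ¬ halts) ∧
      ((f n).WeakTraceInclusion ↔ ¬ halts) ∧ ((f n).WeakTraceEquivalence ↔ ¬ halts) := by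
  obtain ⟨k, hk, hP⟩ := P.exists_below
  obtain ⟨f, hf, hI⟩ := exists_instances hk hP
  refine ⟨f, hf, fun n => ?_⟩
  obtain ⟨henc, hτ, hp, hm, hq, hn⟩ := hI n
  have hsub := traces_left_subset_right_iff (n := n) hk hP
  have hsup := traces_right_subset_left (P := P) (k := k) (n := n)
  have hincl : (f n).StrongTraceInclusion ↔
      ¬ ∃ y, P.Rel (Function.update (fun _ => 0) 0 n) y := by
    rw [← hsub]
    unfold OCNInstance.StrongTraceInclusion OCNInstance.left OCNInstance.right
    rw [hm, hn]
    exact henc.strongTraces_subset_iff stateCode_injective Encodable.encode_injective 0 0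
      hp.symm hq.symm
  have hrev : strongTraces (f n).net.Step (f n).right ⊆
      strongTraces (f n).net.Step (f n).left := by
    unfold OCNInstance.left OCNInstance.right
    rw [hm, hn]
    exact (henc.strongTraces_subset_iff stateCode_injective Encodable.encode_injective 0 0
      hq.symm hp.symm).2 hsup
  have hequiv : (f n).StrongTraceEquivalence ↔ (f n).StrongTraceInclusion :=
    ⟨fun h => h.subset, fun h => h.antisymm hrev⟩
  -- The code of `Letter.tau` is reserved for the internal action, yet no transition carries it
  -- because `Letter.Used` excludes it.
  have hweak := weakTraces_eq_strongTraces (τ := (f n).tau) (step := (f n).net.Step) (by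
    intro x y h
    obtain ⟨d, hd, -⟩ := (OCNInstance.step_iff _ _ _).1 h
    obtain ⟨s, b, t, hT, -, hb, -⟩ := (henc _ _ _ _).1 hd
    have : b = Letter.tau := Encodable.encode_injective (hb.trans hτ)
    subst this
    exact used_of_trans hk hP hT)
  refine ⟨hincl, hequiv.trans hincl, ?_, ?_⟩
  · unfold OCNInstance.WeakTraceInclusion
    rw [hweak, hweak]
    exact hincl
  · unfold OCNInstance.WeakTraceEquivalence
    rw [hweak, hweak]
    exact hequiv.trans hincl

end ProgramNet

/-! ### Reduction from the halting problem -/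

open Nat.Partrec in
/-- The halting problem for codes of partial recursive functions is the halting problem of a
counter program. -/
theorem CounterProg.exists_universal :
    ∃ P : CounterProg, ∀ c : Code,
      (∃ y, P.Rel (Function.update (fun _ => 0) 0 (Encodable.encode c)) y) ↔ (c.eval 0).Dom := by
  -- `G` vanishes at `(k, c)` exactly if evaluating `c` on 0 with fuel `k` succeeds; halting is its
  -- projection over `k`.
  let G : List.Vector ℕ 2 → ℕ := fun v =>
    bif (Code.evaln v.head (Denumerable.ofNat Code v.tail.head) 0).isSome then 0 else 1
  have hG : Primrec G :=
    Primrec.cond (Primrec.option_isSome.comp (Code.primrec_evaln.comp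
      ((Primrec.vector_head.pair ((Primrec.ofNat Code).comp
        (Primrec.vector_head.comp Primrec.vector_tail))).pair (.const 0)))) (.const 0) (.const 1)
  obtain ⟨P, hP⟩ := exists_rel_iff (Nat.Primrec'.of_prim hG)
  refine ⟨P, fun c => (hP _).trans ?_⟩
  have hval : ∀ m, G (m ::ᵥ Encodable.encode c ::ᵥ .nil) = 0 ↔ ∃ x, x ∈ Code.evaln m c 0 := by
    intro m
    simp only [G, List.Vector.head_cons, List.Vector.tail_cons, Denumerable.ofNat_encode]
    cases Code.evaln m c 0 <;> simp
  simp only [hval, Part.dom_iff_mem, Code.evaln_complete]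
  exact exists_comm

theorem not_computablePred_of_reduction {p : OCNInstance → Prop} {f : ℕ → OCNInstance}
    (hf : Computable f)
    (h : ∀ c : Nat.Partrec.Code, p (f (Encodable.encode c)) ↔ ¬ (c.eval 0).Dom) :
    ¬ ComputablePred p := by
  intro hp
  obtain ⟨g, hg, rfl⟩ := ComputablePred.computable_iff.1 hp
  have hcomp : ComputablePred fun c : Nat.Partrec.Code => ¬ (c.eval 0).Dom :=
    ComputablePred.computable_iff.2 ⟨fun c => g (f (Encodable.encode c)),
      hg.comp (hf.comp Computable.encode), funext fun c => propext (h c).symm⟩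
  -- A decision procedure for non-halting gives one for halting by complementation.
  exact ComputablePred.halting_problem 0 (hcomp.not.of_eq fun c => not_not)

theorem mainTheorem5 :
    ¬ ComputablePred OCNInstance.StrongTraceInclusion ∧
    ¬ ComputablePred OCNInstance.StrongTraceEquivalence ∧
    ¬ ComputablePred OCNInstance.WeakTraceInclusion ∧
    ¬ ComputablePred OCNInstance.WeakTraceEquivalence := by
  obtain ⟨P, hP⟩ := CounterProg.exists_universal
  obtain ⟨f, hf, h⟩ := ProgramNet.exists_reduction P
  refine ⟨not_computablePred_of_reduction hf fun c => ?_,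
    not_computablePred_of_reduction hf fun c => ?_,
    not_computablePred_of_reduction hf fun c => ?_,
    not_computablePred_of_reduction hf fun c => ?_⟩
  · rw [← hP c]; exact (h _).1
  · rw [← hP c]; exact (h _).2.1
  · rw [← hP c]; exact (h _).2.2.1
  · rw [← hP c]; exact (h _).2.2.2
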